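/- **Setting.** Let $N\ge 2$. A *convex core* is a compact convex set $C\subset\mathbb R^N$ with nonempty interior and boundary $\partial C$ of class $C^2$; let $\nu$ be its outward unit normal and $S_c$ its shape operator, with the sign convention $D\nu(c)[v]=-S_cv$. An open set $\Omega\subset\mathbb R^N$ with $C\subset\Omega$ is *admissible* for $C$ if $\partial\Omega$ is locally a Lipschitz graph outside $C$, every ray $\{c+t\nu(c):t\ge0\}$, $c\in\partial C$, meets $\Omega$ in a connected set, for almost every $x\in\partial\Omega$ (with respect to surface measure) at which the inward unit normal $n(x)$ exists the half-line $\{x+tn(x):t\ge 0\}$ meets $C$, and the *thickness* $d(c)=\sup\{r\ge0: c+r\nu(c)\in\Omega\}$ is finite for every $c\in\partial C$. The *return map* is $F=\pi\circ\Phi$ on $\partial C$, where $\Phi(c)=c+d(c)\nu(c)$ and $\pi(x)=x+t(x)n(x)$, with $t(x)$ the smallest $t\ge0$ such that $x+tn(x)\in C$. Put $$A(c)=2d(c)\,\bigl(I-d(c)S_c\bigr)^{-1}\quad\text{on } T_c(\partial C),$$ and let $\mathrm{Hess}_{\partial C}\,d(c)$ be the Riemannian Hessian operator of $d$ on $\partial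 C$. A *configuration* $(C,\Omega,c^*)$ consists of a convex core $C$, an admissible $\Omega$ whose thickness $d$ is of class $C^2$ on $\partial C$, and a nondegenerate critical point $c^*\in\partial C$ of $d$. **Proposition.** At a nondegenerate critical point, the linearization $DF(c^*)$ determines only the composite operator $A(c^*)\,\mathrm{Hess}_{\partial C}\,d(c^*)$, not the two factors separately. That is: 1. For every configuration $(C,\Omega,c^*)$, $F(c^*)=c^*$ and $F$ is differentiable at $c^*$ along $\partial C$. 2. If $(C,\Omega,c^*)$ and $(C',\Omega',c^*)$ are configurations with the same outward normal of the core at $c^*$ (in particular, if $C=C'$), with associated $F,A,d$ and $F',A',d'$, then $$DF(c^*)=DF'(c^*)\iff A(c^*)\,\mathrm{Hess}_{\partial C}\,d(c^*)=A'(c^*)\,\mathrm{Hess}_{\partial C'}\,d'(c^*).$$ 3. For every configuration $(C,\Omega,c^*)$ there is a configuration $(C',\Omega',c^*)$ with the same outward normal of the core at $c^*$ and with $DF'(c^*)=DF(c^*)$, but $A'(c^*)\ne A(c^*)$ and $\mathrm{Hess}_{\partial C'}\,d'(c^*)\ne\mathrm{Hess}_{\partial C}\,d(c^*)$. 4. Even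 when the core and the point are prescribed the factors are not determined: for every convex core $C$ and every $c^*\in\partial C$ there are configurations $(C,\Omega,c^*)$ and $(C,\Omega',c^*)$ with $DF(c^*)=DF'(c^*)$, $A(c^*)\ne A'(c^*)$ and $\mathrm{Hess}_{\partial C}\,d(c^*)\ne\mathrm{Hess}_{\partial C}\,d'(c^*)$. -/

import Mathlib

open Set Filter Topology MeasureTheory
open scoped RealInnerProductSpace

noncomputable section

namespace RoundTrip

/-- `ν` is the outward unit normal of the set `S` at `x`: the set `S` contains, near `x`, every open
cone strictly inside the half-space `⟪y - x, ν⟫ < 0` and misses every open cone strictly inside the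
opposite half-space. For a set which is locally the subgraph of a Lipschitz function this says
exactly that the function is differentiable at the corresponding point, with graph orthogonal
to `ν` there. -/
def IsOutwardUnitNormal {N : ℕ} (S : Set (EuclideanSpace ℝ (Fin N)))
    (x ν : EuclideanSpace ℝ (Fin N)) : Prop :=
  ‖ν‖ = 1 ∧ ∀ ε : ℝ, 0 < ε → ∀ᶠ y in 𝓝 x,
    (⟪y - x, ν⟫ < -(ε * ‖y - x‖) → y ∈ S) ∧ (ε * ‖y - x‖ < ⟪y - x, ν⟫ → y ∉ S)

open Classical in
/-- The outward unit normal of `S` at `x` (zero where it does not exist). -/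
def outwardNormal {N : ℕ} (S : Set (EuclideanSpace ℝ (Fin N)))
    (x : EuclideanSpace ℝ (Fin N)) : EuclideanSpace ℝ (Fin N) :=
  if h : ∃ ν, IsOutwardUnitNormal S x ν then h.choose else 0

/-- A compact convex set with nonempty interior whose boundary is a hypersurface of class `C²`,
expressed by local defining functions. -/
structure IsConvexCore {N : ℕ} (C : Set (EuclideanSpace ℝ (Fin N))) : Prop where
  isCompact : IsCompact C
  convex : Convex ℝ C
  interior_nonempty : (interior C).Nonempty
  boundary_C2 : ∀ c ∈ frontier C, ∃ ρ : EuclideanSpace ℝ (Fin N) → ℝ,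
    ContDiffAt ℝ 2 ρ c ∧ fderiv ℝ ρ c ≠ 0 ∧ ∀ᶠ y in 𝓝 c, (y ∈ C ↔ ρ y ≤ 0)

/-- The outward normal half-line of `C` issued from `c`. -/
def normalRay {N : ℕ} (C : Set (EuclideanSpace ℝ (Fin N))) (c : EuclideanSpace ℝ (Fin N)) :
    Set (EuclideanSpace ℝ (Fin N)) :=
  {y | ∃ t : ℝ, 0 ≤ t ∧ y = c + t • outwardNormal C c}

/-- Near `x`, the set `Ω` is the strict subgraph, in some direction `e`, of a Lipschitz function
on the hyperplane orthogonal to `e`. -/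
def IsLipschitzBoundaryAt {N : ℕ} (Ω : Set (EuclideanSpace ℝ (Fin N)))
    (x : EuclideanSpace ℝ (Fin N)) : Prop :=
  ∃ (e : EuclideanSpace ℝ (Fin N)) (K : NNReal) (g : EuclideanSpace ℝ (Fin N) → ℝ),
    ‖e‖ = 1 ∧ LipschitzWith K g ∧ ∀ᶠ y in 𝓝 x, (y ∈ Ω ↔ ⟪e, y⟫ < g (y - ⟪e, y⟫ • e))

/-- The `C`-geometric normal property: `Ω` is an open set containing `C` and, for almost every
boundary point with respect to surface measure at which the inward unit normal `n` exists, the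
half-line from this point in the direction `n` meets `C`. -/
def GeometricNormalProperty {N : ℕ} (C Ω : Set (EuclideanSpace ℝ (Fin N))) : Prop :=
  IsOpen Ω ∧ C ⊆ Ω ∧
    ∀ᵐ x ∂(μH[(N : ℝ) - 1] : Measure (EuclideanSpace ℝ (Fin N))), x ∈ frontier Ω →
      ∀ n, IsOutwardUnitNormal Ω x (-n) → ∃ t : ℝ, 0 ≤ t ∧ x + t • n ∈ C

/-- The class of admissible domains around the core `C`. The last field says that the supremum
defining the thickness function is finite. -/
structure IsAdmissible {N : ℕ} (C Ω : Set (EuclideanSpace ℝ (Fin N))) : Prop where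
  isOpen : IsOpen Ω
  interior_subset : interior C ⊆ Ω
  lipschitz : ∀ x ∈ frontier Ω \ C, IsLipschitzBoundaryAt Ω x
  ray_connected : ∀ c ∈ frontier C, IsConnected (normalRay C c ∩ Ω)
  normal_property : GeometricNormalProperty C Ω
  finite_thickness : ∀ c ∈ frontier C,
    BddAbove {r : ℝ | 0 ≤ r ∧ c + r • outwardNormal C c ∈ Ω}

/-- The thickness function `d(c) = sup {r ≥ 0 : c + r ν(c) ∈ Ω}`. -/
def thickness {N : ℕ} (C Ω : Set (EuclideanSpace ℝ (Fin N)))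
    (c : EuclideanSpace ℝ (Fin N)) : ℝ :=
  sSup {r : ℝ | 0 ≤ r ∧ c + r • outwardNormal C c ∈ Ω}

/-- The radial map `Φ(c) = c + d(c) ν(c)`. -/
def radialMap {N : ℕ} (C Ω : Set (EuclideanSpace ℝ (Fin N)))
    (c : EuclideanSpace ℝ (Fin N)) : EuclideanSpace ℝ (Fin N) :=
  c + thickness C Ω c • outwardNormal C c

/-- The inward unit normal of `Ω`. -/
def inwardNormal {N : ℕ} (Ω : Set (EuclideanSpace ℝ (Fin N)))
    (x : EuclideanSpace ℝ (Fin N)) : EuclideanSpace ℝ (Fin N) :=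
  -outwardNormal Ω x

/-- The smallest `t ≥ 0` with `x + t n(x) ∈ C`. -/
def returnTime {N : ℕ} (C Ω : Set (EuclideanSpace ℝ (Fin N)))
    (x : EuclideanSpace ℝ (Fin N)) : ℝ :=
  sInf {t : ℝ | 0 ≤ t ∧ x + t • inwardNormal Ω x ∈ C}

/-- The reciprocal map `π(x) = x + t(x) n(x)`. -/
def reciprocalMap {N : ℕ} (C Ω : Set (EuclideanSpace ℝ (Fin N)))
    (x : EuclideanSpace ℝ (Fin N)) : EuclideanSpace ℝ (Fin N) :=
  x + returnTime C Ω x • inwardNormal Ω x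

/-- The return map `F = π ∘ Φ` (used on `frontier C` only). -/
def returnMap {N : ℕ} (C Ω : Set (EuclideanSpace ℝ (Fin N)))
    (c : EuclideanSpace ℝ (Fin N)) : EuclideanSpace ℝ (Fin N) :=
  reciprocalMap C Ω (radialMap C Ω c)

/-- The tangent space of `frontier C` at `c`, as a linear hyperplane. -/
def tangentSpace {N : ℕ} (C : Set (EuclideanSpace ℝ (Fin N)))
    (c : EuclideanSpace ℝ (Fin N)) : Submodule ℝ (EuclideanSpace ℝ (Fin N)) :=
  (ℝ ∙ outwardNormal C c)ᗮ

/-- The orthogonal projection onto the tangent space, as an operator on the ambient space. -/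
def tangentProj {N : ℕ} (C : Set (EuclideanSpace ℝ (Fin N)))
    (c : EuclideanSpace ℝ (Fin N)) : EuclideanSpace ℝ (Fin N) →L[ℝ] EuclideanSpace ℝ (Fin N) :=
  (tangentSpace C c).starProjection

/-- `L` is the differential at `c` of the restriction of `f` to the hypersurface `frontier C`.
Linear maps on the tangent space are represented throughout by their extension by zero to the
normal line; this makes `L` unique. -/
def HasSurfaceDerivAt {N : ℕ} {G : Type*} [NormedAddCommGroup G] [NormedSpace ℝ G]
    (C : Set (EuclideanSpace ℝ (Fin N))) (f : EuclideanSpace ℝ (Fin N) → G)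
    (L : EuclideanSpace ℝ (Fin N) →L[ℝ] G) (c : EuclideanSpace ℝ (Fin N)) : Prop :=
  HasFDerivWithinAt f L (frontier C) c ∧ L (outwardNormal C c) = 0

open Classical in
/-- The differential along the hypersurface `frontier C` (zero if it does not exist). -/
def surfaceDeriv {N : ℕ} {G : Type*} [NormedAddCommGroup G] [NormedSpace ℝ G]
    (C : Set (EuclideanSpace ℝ (Fin N))) (f : EuclideanSpace ℝ (Fin N) → G)
    (c : EuclideanSpace ℝ (Fin N)) : EuclideanSpace ℝ (Fin N) →L[ℝ] G :=
  if h : ∃ L, HasSurfaceDerivAt C f L c then h.choose else 0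

/-- The Riemannian gradient on `frontier C` of a real function. -/
def surfaceGrad {N : ℕ} (C : Set (EuclideanSpace ℝ (Fin N)))
    (f : EuclideanSpace ℝ (Fin N) → ℝ) (c : EuclideanSpace ℝ (Fin N)) :
    EuclideanSpace ℝ (Fin N) :=
  (InnerProductSpace.toDual ℝ (EuclideanSpace ℝ (Fin N))).symm (surfaceDeriv C f c)

/-- The Riemannian Hessian operator on `frontier C`: the covariant derivative (that is, the
tangential part of the derivative) of the gradient field. -/
def surfaceHess {N : ℕ} (C : Set (EuclideanSpace ℝ (Fin N)))
    (f : EuclideanSpace ℝ (Fin N) → ℝ) (c : EuclideanSpace ℝ (Fin N)) :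
    EuclideanSpace ℝ (Fin N) →L[ℝ] EuclideanSpace ℝ (Fin N) :=
  tangentProj C c ∘L surfaceDeriv C (surfaceGrad C f) c

/-- The shape operator, with the sign convention `Dν(c)[v] = -S_c v`. -/
def shapeOperator {N : ℕ} (C : Set (EuclideanSpace ℝ (Fin N))) (c : EuclideanSpace ℝ (Fin N)) :
    EuclideanSpace ℝ (Fin N) →L[ℝ] EuclideanSpace ℝ (Fin N) :=
  -surfaceDeriv C (outwardNormal C) c

/-- The geometric operator `A(c) = 2 d(c) (I - d(c) S_c)⁻¹` on the tangent space (extended by zero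
to the normal line; the ambient operator `I - d(c) S_c` preserves the tangent space and is the
identity on the normal line). -/
def geometricOperator {N : ℕ} (C Ω : Set (EuclideanSpace ℝ (Fin N)))
    (c : EuclideanSpace ℝ (Fin N)) : EuclideanSpace ℝ (Fin N) →L[ℝ] EuclideanSpace ℝ (Fin N) :=
  (2 * thickness C Ω c) •
    ((ContinuousLinearMap.id ℝ (EuclideanSpace ℝ (Fin N)) -
        thickness C Ω c • shapeOperator C c).inverse ∘L tangentProj C c)

/-- The Hessian `Hess_{∂C} d(c)` of the thickness function. -/
def thicknessHess {N : ℕ} (C Ω : Set (EuclideanSpace ℝ (Fin N)))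
    (c : EuclideanSpace ℝ (Fin N)) : EuclideanSpace ℝ (Fin N) →L[ℝ] EuclideanSpace ℝ (Fin N) :=
  surfaceHess C (thickness C Ω) c

/-- The linearization `DF(c)` of the return map. -/
def linearization {N : ℕ} (C Ω : Set (EuclideanSpace ℝ (Fin N)))
    (c : EuclideanSpace ℝ (Fin N)) : EuclideanSpace ℝ (Fin N) →L[ℝ] EuclideanSpace ℝ (Fin N) :=
  surfaceDeriv C (returnMap C Ω) c

/-- `c` is a critical point of `f` on `frontier C` with nondegenerate Hessian. -/
def IsNondegenerateCriticalPoint {N : ℕ} (C : Set (EuclideanSpace ℝ (Fin N)))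
    (f : EuclideanSpace ℝ (Fin N) → ℝ) (c : EuclideanSpace ℝ (Fin N)) : Prop :=
  c ∈ frontier C ∧ surfaceGrad C f c = 0 ∧
    ∀ v ∈ tangentSpace C c, surfaceHess C f c v = 0 → v = 0

/-- A convex core, an admissible domain around it with thickness function of class `C²`, and a
nondegenerate critical point of the thickness function. On the set `frontier C`, which is a
`C²` hypersurface, `ContDiffOn ℝ 2` is the usual `C²` regularity in charts. -/
structure IsCriticalConfiguration {N : ℕ} (C Ω : Set (EuclideanSpace ℝ (Fin N)))
    (c : EuclideanSpace ℝ (Fin N)) : Prop where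
  core : IsConvexCore C
  admissible : IsAdmissible C Ω
  thickness_C2 : ContDiffOn ℝ 2 (thickness C Ω) (frontier C)
  critical : IsNondegenerateCriticalPoint C (thickness C Ω) c

end RoundTrip

end

namespace RoundTrip

variable {N : ℕ}

local notation "E" => EuclideanSpace ℝ (Fin N)

section

/-! ### Outward normals -/

/-! Let `P` be the nearest point map of the core and `h` the distance to it. Every point outside `C`
is `P y + h(y) ν(P y)`, and there an admissible `Ω` is the set `h < d ∘ P`. The gradient of `h` is
`ν ∘ P`, and `DP` is the tangential projection followed by `M = (I - hS)⁻¹`; convexity gives `S ≤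
0`, so `M` exists at every distance. Hence `w = ν - M grad d` is an outward normal vector of `Ω` at
`Φ(c)` (`isOutwardUnitNormal_radial`).

At a critical point `w = ν`, `Dw = -S - M Hess d` and `DΦ = I - dS`. In `Φ - d(c*) w` the shape
operators cancel, leaving the derivative `I + d M Hess d` along the boundary. Its values are
tangential and the half-lines are transversal to the boundary, so the hitting time deviates from
`d(c*)` only by `o(z - c*)` and the hitting point has the same derivative
(`hasFDerivWithinAt_firstHit`). Thus `DF = I + ½ A Hess d` on the tangent space (`returnMap_spec`),
from which parts 1 and 2 follow. The boundary being only `C²`, `S` and `M` are merely continuous; `M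
grad d` is differentiable at `c*` because `grad d` vanishes there.

For parts 3 and 4, any positive thickness and any symmetric nondegenerate tangential operator can be
realized at a given boundary point (`exists_configuration`): take a tube of constant thickness and
perturb it by a quadratic bump, rescaled so that its Hessian is kept while its gradient becomes
small.

Part 3: an ellipsoid with `S' = 2S - I/d` satisfies `I - dS' = 2(I - dS)`, so `A` is halved at the
same thickness, and the Hessian is doubled to compensate; this needs the symmetry of the Hessian
(`inner_surfaceHess`). Part 4: the Hessian `I/d - S` makes `A Hess d = 2I` for every `d > 0`, so `d
= 1` and `d = 2` give the same linearization. -/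

theorem eventually_ray {x u : E} {p : E → Prop} (h : ∀ᶠ y in 𝓝 x, p y) :
    ∀ᶠ t : ℝ in 𝓝[>] 0, p (x + t • u) := by
  have : Tendsto (fun t : ℝ => x + t • u) (𝓝[>] 0) (𝓝 x) := by
    have : Tendsto (fun t : ℝ => x + t • u) (𝓝 0) (𝓝 (x + (0 : ℝ) • u)) :=
      (Continuous.tendsto (by fun_prop) 0)
    simpa using this.mono_left nhdsWithin_le_nhds
  exact this.eventually h

theorem IsOutwardUnitNormal.eventually_mem {S : Set E} {x ν u : E} (h : IsOutwardUnitNormal S x ν)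
    (hu : ⟪u, ν⟫ < 0) : ∀ᶠ t : ℝ in 𝓝[>] 0, x + t • u ∈ S := by
  have hu0 : u ≠ 0 := by rintro rfl; simp at hu
  have hn : 0 < ‖u‖ := norm_pos_iff.2 hu0
  -- Half the cosine of the angle between `-u` and `ν`, so that the ray lies strictly inside the
  -- cone.
  have he : 0 < -⟪u, ν⟫ / (2 * ‖u‖) := by apply div_pos <;> linarith
  filter_upwards [eventually_ray (u := u) (h.2 _ he), self_mem_nhdsWithin] with t ht (ht0 : 0 < t)
  apply ht.1
  rw [add_sub_cancel_left, inner_smul_left, norm_smul, Real.norm_of_nonneg ht0.le]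
  have : -⟪u, ν⟫ / (2 * ‖u‖) * (t * ‖u‖) = -⟪u, ν⟫ / 2 * t := by field_simp
  rw [this]
  simp only [conj_trivial]
  nlinarith

theorem IsOutwardUnitNormal.eventually_notMem {S : Set E} {x ν u : E}
    (h : IsOutwardUnitNormal S x ν) (hu : 0 < ⟪u, ν⟫) : ∀ᶠ t : ℝ in 𝓝[>] 0, x + t • u ∉ S := by
  have hu0 : u ≠ 0 := by rintro rfl; simp at hu
  have hn : 0 < ‖u‖ := norm_pos_iff.2 hu0
  have he : 0 < ⟪u, ν⟫ / (2 * ‖u‖) := by apply div_pos <;> linarith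
  filter_upwards [eventually_ray (u := u) (h.2 _ he), self_mem_nhdsWithin] with t ht (ht0 : 0 < t)
  apply ht.2
  rw [add_sub_cancel_left, inner_smul_left, norm_smul, Real.norm_of_nonneg ht0.le]
  have : ⟪u, ν⟫ / (2 * ‖u‖) * (t * ‖u‖) = ⟪u, ν⟫ / 2 * t := by field_simp
  rw [this]
  simp only [conj_trivial]
  nlinarith

theorem inner_lt_one_of_ne {ν ν' : E} (h : ‖ν‖ = 1) (h' : ‖ν'‖ = 1) (hne : ν ≠ ν') :
    ⟪ν, ν'⟫ < 1 :=
  (inner_lt_one_iff_real_of_norm_eq_one h h').2 hne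

/-- The direction `ν' - ν` would point into `S` according to `ν` and out of `S` according to `ν'`.
-/
theorem IsOutwardUnitNormal.unique {S : Set E} {x ν ν' : E} (h : IsOutwardUnitNormal S x ν)
    (h' : IsOutwardUnitNormal S x ν') : ν = ν' := by
  by_contra hne
  have h1 := inner_lt_one_of_ne h.1 h'.1 hne
  have e1 : ⟪ν' - ν, ν⟫ < 0 := by
    rw [inner_sub_left, real_inner_self_eq_norm_sq, h.1, real_inner_comm]; linarith
  have e2 : 0 < ⟪ν' - ν, ν'⟫ := by
    rw [inner_sub_left, real_inner_self_eq_norm_sq, h'.1]; linarith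
  obtain ⟨t, ht, ht'⟩ := ((h.eventually_mem e1).and (h'.eventually_notMem e2)).exists
  exact ht' ht

theorem IsOutwardUnitNormal.outwardNormal_eq {S : Set E} {x ν : E}
    (h : IsOutwardUnitNormal S x ν) : outwardNormal S x = ν := by
  have hex : ∃ ν, IsOutwardUnitNormal S x ν := ⟨ν, h⟩
  rw [outwardNormal, dif_pos hex]
  exact hex.choose_spec.unique h

/-- The outward normal of a set given near `x` by a differentiable defining function. -/
theorem isOutwardUnitNormal_of_hasFDerivAt {S : Set E} {h : E → ℝ} {w x : E}
    (hd : HasFDerivAt h (innerSL ℝ w) x) (hx : h x = 0) (hw : w ≠ 0)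
    (hS : ∀ᶠ y in 𝓝 x, (h y < 0 → y ∈ S) ∧ (0 < h y → y ∉ S)) :
    IsOutwardUnitNormal S x (‖w‖⁻¹ • w) := by
  have hn : 0 < ‖w‖ := norm_pos_iff.2 hw
  refine ⟨by rw [norm_smul, norm_inv, norm_norm, inv_mul_cancel₀ hn.ne'], fun ε hε => ?_⟩
  have hlo := (hasFDerivAt_iff_isLittleO.1 hd).def (mul_pos hε hn)
  filter_upwards [hS, hlo] with y hy hb
  rw [hx, sub_zero, innerSL_apply_apply, Real.norm_eq_abs, abs_le] at hb
  rw [inner_smul_right, real_inner_comm]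
  have key : ⟪w, y - x⟫ = ‖w‖ * (‖w‖⁻¹ * ⟪w, y - x⟫) := by field_simp
  constructor
  · intro h1
    apply hy.1
    nlinarith
  · intro h1
    apply hy.2
    nlinarith

/-- The open cones about `-ν` and `ν` lie in `S` and in its complement, so neither contains a
frontier point: the frontier is tangent to the hyperplane orthogonal to `ν`. -/
theorem IsOutwardUnitNormal.isLittleO_inner {S : Set E} {x ν : E}
    (h : IsOutwardUnitNormal S x ν) :
    (fun z => ⟪z - x, ν⟫) =o[𝓝[frontier S] x] fun z => z - x := by
  refine Asymptotics.isLittleO_iff.2 fun ε hε => ?_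
  have h1 := (h.2 ε hε).eventually_nhds
  filter_upwards [nhdsWithin_le_nhds h1, self_mem_nhdsWithin] with z hz hzf
  have hc1 : Continuous fun y : E => ⟪y - x, ν⟫ := by fun_prop
  have hc2 : Continuous fun y : E => ε * ‖y - x‖ := by fun_prop
  rw [Real.norm_eq_abs, abs_le]
  constructor
  · by_contra! hlt
    have : z ∈ interior S := by
      rw [mem_interior_iff_mem_nhds]
      filter_upwards [hz, hc1.continuousAt.eventually_lt hc2.neg.continuousAt hlt] with y hy hy'
      exact hy.1 hy'
    exact hzf.2 this
  · by_contra! hlt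
    have : z ∈ interior Sᶜ := by
      rw [mem_interior_iff_mem_nhds]
      filter_upwards [hz, hc2.continuousAt.eventually_lt hc1.continuousAt hlt] with y hy hy'
      exact hy.2 hy'
    rw [interior_compl] at this
    exact this hzf.1

/-- Otherwise the interior and the exterior of `S` would disconnect the segment. -/
theorem exists_mem_frontier_segment {S : Set E} {a b : E} (ha : a ∈ S) (hb : b ∉ S) :
    ∃ s ∈ Icc (0 : ℝ) 1, a + s • (b - a) ∈ frontier S := by
  by_contra! hcon
  have hpre : IsPreconnected (segment ℝ a b) := (convex_segment a b).isPreconnected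
  have hsub : segment ℝ a b ⊆ interior S ∪ (closure S)ᶜ := by
    rw [segment_eq_image']
    rintro _ ⟨s, hs, rfl⟩
    have := hcon s hs
    rw [frontier, Set.mem_sdiff, not_and_not_right] at this
    by_cases h : a + s • (b - a) ∈ closure S
    · exact Or.inl (this h)
    · exact Or.inr h
  have h1 : (segment ℝ a b ∩ interior S).Nonempty := by
    refine ⟨a, left_mem_segment _ _ _, ?_⟩
    rcases hsub (left_mem_segment _ _ _) with h | h
    · exact h
    · exact absurd (subset_closure ha) h
  have h2 : (segment ℝ a b ∩ (closure S)ᶜ).Nonempty := by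
    refine ⟨b, right_mem_segment _ _ _, ?_⟩
    rcases hsub (right_mem_segment _ _ _) with h | h
    · exact absurd (interior_subset h) hb
    · exact h
  obtain ⟨y, -, hy1, hy2⟩ := hpre _ _ isOpen_interior isClosed_closure.isOpen_compl hsub h1 h2
  exact hy2 (subset_closure (interior_subset hy1))

/-- Every tangent vector is the velocity of a curve in the frontier. -/
theorem IsOutwardUnitNormal.exists_curve {S : Set E} {x ν v : E} (h : IsOutwardUnitNormal S x ν)
    (hv : ⟪v, ν⟫ = 0) :
    ∃ γ : ℝ → E, (∀ᶠ t in 𝓝[>] (0 : ℝ), x + γ t ∈ frontier S) ∧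
      Tendsto (fun t : ℝ => t⁻¹ • γ t) (𝓝[>] 0) (𝓝 v) := by
  -- The segment of half-length `tη` in the direction `ν`, centred at `x + t v`, starts in `S` and
  -- ends outside it.
  have key : ∀ η : ℝ, 0 < η → ∀ᶠ t in 𝓝[>] (0 : ℝ),
      ∃ s ∈ Icc (-(t * η)) (t * η), x + (t • v + s • ν) ∈ frontier S := by
    intro η hη
    have e1 : ⟪v - η • ν, ν⟫ < 0 := by
      rw [inner_sub_left, hv, inner_smul_left, real_inner_self_eq_norm_sq, h.1]; simpa using hη
    have e2 : 0 < ⟪v + η • ν, ν⟫ := by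
      rw [inner_add_left, hv, inner_smul_left, real_inner_self_eq_norm_sq, h.1]; simpa using hη
    filter_upwards [h.eventually_mem e1, h.eventually_notMem e2, self_mem_nhdsWithin]
      with t h1 h2 (ht : 0 < t)
    obtain ⟨s, hs, hsf⟩ := exists_mem_frontier_segment h1 h2
    have htη := mul_pos ht hη
    refine ⟨-(t * η) + 2 * s * (t * η), ⟨?_, ?_⟩, ?_⟩
    · nlinarith [hs.1]
    · nlinarith [hs.2]
    · convert hsf using 1
      module
  classical
  -- One choice of `s` must serve every `η`, so it is taken nearly minimal. The infimum need not be
  -- attained; the added `t` is slack that disappears in the limit.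
  let P : ℝ → ℝ → Prop := fun t s => |s| ≤ 2 * (sInf {η : ℝ | 0 ≤ η ∧
    ∃ s, |s| ≤ t * η ∧ x + (t • v + s • ν) ∈ frontier S} + t) * t ∧
      x + (t • v + s • ν) ∈ frontier S
  have hbdd : ∀ t, BddBelow {η : ℝ | 0 ≤ η ∧
    ∃ s, |s| ≤ t * η ∧ x + (t • v + s • ν) ∈ frontier S} := fun t => ⟨0, fun η hη => hη.1⟩
  have hP : ∀ᶠ t in 𝓝[>] (0 : ℝ), ∃ s, P t s := by
    filter_upwards [key 1 one_pos, self_mem_nhdsWithin] with t ht (ht0 : 0 < t)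
    obtain ⟨s, hs, hsf⟩ := ht
    have hne : {η : ℝ | 0 ≤ η ∧
      ∃ s, |s| ≤ t * η ∧ x + (t • v + s • ν) ∈ frontier S}.Nonempty :=
      ⟨1, zero_le_one, s, abs_le.2 hs, hsf⟩
    obtain ⟨η, ⟨hη0, s', hs', hsf'⟩, hlt⟩ := exists_lt_of_csInf_lt hne (lt_add_of_pos_right _ ht0)
    refine ⟨s', hs'.trans ?_, hsf'⟩
    nlinarith
  let σ : ℝ → ℝ := fun t => if h : ∃ s, P t s then h.choose else 0
  have hσ : ∀ᶠ t in 𝓝[>] (0 : ℝ), P t (σ t) := by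
    filter_upwards [hP] with t ht
    simp only [σ, dif_pos ht]
    exact ht.choose_spec
  refine ⟨fun t => t • v + σ t • ν, hσ.mono fun t ht => ht.2, ?_⟩
  have hlim : Tendsto (fun t => t⁻¹ * σ t) (𝓝[>] 0) (𝓝 0) := by
    rw [Metric.tendsto_nhds]
    intro ε hε
    have hsmall : ∀ᶠ t : ℝ in 𝓝[>] 0, t < ε / 8 :=
      nhdsWithin_le_nhds (gt_mem_nhds (by positivity))
    filter_upwards [hσ, key (ε / 8) (by positivity), hsmall, self_mem_nhdsWithin]
      with t ht hk hts (ht0 : 0 < t)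
    obtain ⟨s, hs, hsf⟩ := hk
    have hle := csInf_le (hbdd t) ⟨by positivity, s, abs_le.2 hs, hsf⟩
    rw [dist_zero_right, Real.norm_eq_abs, abs_mul, abs_inv, abs_of_pos ht0]
    rw [inv_mul_lt_iff₀ ht0]
    refine ht.1.trans_lt ?_
    nlinarith
  have : Tendsto (fun t : ℝ => v + (t⁻¹ * σ t) • ν) (𝓝[>] 0) (𝓝 (v + (0 : ℝ) • ν)) :=
    tendsto_const_nhds.add (hlim.smul_const ν)
  rw [zero_smul, add_zero] at this
  refine this.congr' ?_
  filter_upwards [self_mem_nhdsWithin] with t (ht0 : 0 < t)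
  rw [smul_add, smul_smul, smul_smul, inv_mul_cancel₀ ht0.ne', one_smul]

theorem IsOutwardUnitNormal.hasFDerivWithinAt_lim {G : Type*} [NormedAddCommGroup G]
    [NormedSpace ℝ G] {S : Set E} {x ν v : E} (h : IsOutwardUnitNormal S x ν) (hv : ⟪v, ν⟫ = 0)
    {f : E → G} {L : E →L[ℝ] G} (hf : HasFDerivWithinAt f L (frontier S) x) :
    ∃ γ : ℝ → E, (∀ᶠ t in 𝓝[>] (0 : ℝ), x + γ t ∈ frontier S) ∧
      Tendsto (fun t : ℝ => t⁻¹ • γ t) (𝓝[>] 0) (𝓝 v) ∧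
      Tendsto (fun t : ℝ => t⁻¹ • (f (x + γ t) - f x)) (𝓝[>] 0) (𝓝 (L v)) := by
  obtain ⟨γ, h1, h2⟩ := h.exists_curve hv
  refine ⟨γ, h1, h2, hf.lim ?_ h1 h2⟩
  have h3 : Tendsto (fun t : ℝ => t • (t⁻¹ • γ t)) (𝓝[>] 0) (𝓝 ((0 : ℝ) • v)) :=
    (tendsto_id.mono_left nhdsWithin_le_nhds).smul h2
  rw [zero_smul] at h3
  refine h3.congr' ?_
  filter_upwards [self_mem_nhdsWithin] with t (ht0 : 0 < t)
  rw [smul_smul, mul_inv_cancel₀ ht0.ne', one_smul]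

/-! ### Differentials along a hypersurface -/

theorem tangentProj_apply {C : Set E} {c ν : E} (h : IsOutwardUnitNormal C c ν) (v : E) :
    tangentProj C c v = v - ⟪ν, v⟫ • ν := by
  change ((ℝ ∙ outwardNormal C c)ᗮ).starProjection v = _
  rw [Submodule.starProjection_orthogonal, sub_apply, Submodule.starProjection_singleton, h.outwardNormal_eq, h.1]
  simp

theorem mem_tangentSpace_iff {C : Set E} {c ν : E} (h : IsOutwardUnitNormal C c ν) (v : E) :
    v ∈ tangentSpace C c ↔ ⟪ν, v⟫ = 0 := by
  rw [tangentSpace, Submodule.mem_orthogonal_singleton_iff_inner_right, h.outwardNormal_eq]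

variable {G : Type*} [NormedAddCommGroup G] [NormedSpace ℝ G]

/-- Tangent vectors are velocities of curves in the frontier, which fixes the values there; the
normal line is fixed by the convention of extension by zero. -/
theorem HasSurfaceDerivAt.unique {C : Set E} {c ν : E} (h : IsOutwardUnitNormal C c ν) {f : E → G}
    {L L' : E →L[ℝ] G} (hL : HasSurfaceDerivAt C f L c) (hL' : HasSurfaceDerivAt C f L' c) :
    L = L' := by
  ext v
  have hd : (L - L') ν = 0 := by
    have := hL.2; have := hL'.2
    rw [h.outwardNormal_eq] at *
    simp [*]
  have ht : ⟪v - ⟪ν, v⟫ • ν, ν⟫ = 0 := by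
    rw [inner_sub_left, inner_smul_left, real_inner_self_eq_norm_sq, h.1, real_inner_comm]; simp
  obtain ⟨γ, -, -, h3⟩ := h.hasFDerivWithinAt_lim ht (hL.1.sub hL'.1)
  have h4 : (L - L') (v - ⟪ν, v⟫ • ν) = 0 := tendsto_nhds_unique h3 (by simp)
  rw [map_sub, map_smul, hd, smul_zero, sub_zero] at h4
  simpa [sub_eq_zero] using h4

theorem HasSurfaceDerivAt.surfaceDeriv_eq {C : Set E} {c ν : E} (h : IsOutwardUnitNormal C c ν)
    {f : E → G} {L : E →L[ℝ] G} (hL : HasSurfaceDerivAt C f L c) : surfaceDeriv C f c = L := by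
  have hex : ∃ L, HasSurfaceDerivAt C f L c := ⟨L, hL⟩
  rw [surfaceDeriv, dif_pos hex]
  exact hex.choose_spec.unique h hL

/-- Composing with the projection changes the linear part by `⟪z - c, ν⟫ L ν`, which is `o(z - c)`
on the frontier. -/
theorem hasSurfaceDerivAt_comp_tangentProj {C : Set E} {c ν : E} (h : IsOutwardUnitNormal C c ν)
    {f : E → G} {L : E →L[ℝ] G} (hf : HasFDerivWithinAt f L (frontier C) c) :
    HasSurfaceDerivAt C f (L ∘L tangentProj C c) c := by
  refine ⟨?_, ?_⟩
  · rw [hasFDerivWithinAt_iff_isLittleO] at hf ⊢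
    have h2 : (fun z => ⟪z - c, ν⟫ • L ν) =o[𝓝[frontier C] c] fun z => z - c := by
      refine Asymptotics.IsBigO.trans_isLittleO ?_ h.isLittleO_inner
      refine Asymptotics.IsBigO.of_bound ‖L ν‖ (Eventually.of_forall fun z => ?_)
      rw [norm_smul, mul_comm]
    refine (hf.add h2).congr_left fun z => ?_
    rw [ContinuousLinearMap.comp_apply, tangentProj_apply h, map_sub L _ (_ • _), map_smul,
      real_inner_comm]
    abel
  · rw [ContinuousLinearMap.comp_apply, tangentProj_apply h, h.outwardNormal_eq,
      real_inner_self_eq_norm_sq, h.1]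
    simp

theorem hasSurfaceDerivAt_surfaceDeriv {C : Set E} {c ν : E} (h : IsOutwardUnitNormal C c ν)
    {f : E → G} (hf : DifferentiableWithinAt ℝ f (frontier C) c) :
    HasSurfaceDerivAt C f (surfaceDeriv C f c) c := by
  have := hasSurfaceDerivAt_comp_tangentProj h hf.hasFDerivWithinAt
  rwa [this.surfaceDeriv_eq h]

theorem surfaceDeriv_eq_of_hasFDerivWithinAt {C : Set E} {c ν : E} (h : IsOutwardUnitNormal C c ν)
    {f : E → G} {L : E →L[ℝ] G} (hf : HasFDerivWithinAt f L (frontier C) c) :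
    surfaceDeriv C f c = L ∘L tangentProj C c :=
  (hasSurfaceDerivAt_comp_tangentProj h hf).surfaceDeriv_eq h

end

section

/-! ### The normal field and the shape operator of a convex core -/

theorem tangentProj_eq {C : Set E} {c ν : E} (h : IsOutwardUnitNormal C c ν) :
    tangentProj C c = ContinuousLinearMap.id ℝ E - (innerSL ℝ ν).smulRight ν := by
  ext1 v
  rw [tangentProj_apply h]
  simp

theorem frontier_value_eq_zero {C : Set E} (hC : IsClosed C) {c : E} (hc : c ∈ frontier C)
    {ρ : E → ℝ} (hρ : ContinuousAt ρ c) (h : ∀ᶠ y in 𝓝 c, (y ∈ C ↔ ρ y ≤ 0)) : ρ c = 0 := by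
  have hcC : c ∈ C := hC.frontier_subset hc
  refine le_antisymm (h.self_of_nhds.1 hcC) (not_lt.1 fun hlt => hc.2 ?_)
  rw [mem_interior_iff_mem_nhds]
  filter_upwards [h, hρ.eventually_lt continuousAt_const hlt] with y hy hy'
  exact hy.2 hy'.le

/-- The field is `∇ρ / ‖∇ρ‖`, defined on a full neighbourhood. Its derivative is orthogonal to it
because its length is one, and on tangent vectors the derivative is `D²ρ / ‖∇ρ‖`, symmetric because
second derivatives commute. -/
theorem IsConvexCore.exists_normalField {C : Set E} (hC : IsConvexCore C) {c : E}
    (hc : c ∈ frontier C) :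
    ∃ n : E → E, ContDiffAt ℝ 1 n c ∧
      (∀ᶠ z in 𝓝[frontier C] c, IsOutwardUnitNormal C z (n z)) ∧
      (∀ v, ⟪n c, fderiv ℝ n c v⟫ = 0) ∧
      ∀ v w, ⟪n c, v⟫ = 0 → ⟪n c, w⟫ = 0 →
        ⟪fderiv ℝ n c v, w⟫ = ⟪fderiv ℝ n c w, v⟫ := by
  obtain ⟨ρ, hρ, hρ0, hCρ⟩ := hC.boundary_C2 c hc
  set g : E → E := fun z => (InnerProductSpace.toDual ℝ E).symm (fderiv ℝ ρ z) with hg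
  have hgC : ContDiffAt ℝ 1 g c := by
    have h1 : ContDiffAt ℝ 1 (fderiv ℝ ρ) c := hρ.fderiv_right (by norm_num)
    exact (InnerProductSpace.toDual ℝ E).symm.toContinuousLinearEquiv.contDiff.contDiffAt.comp c h1
  have hg0 : g c ≠ 0 := by simpa [hg] using hρ0
  have hginner : ∀ z, innerSL ℝ (g z) = fderiv ℝ ρ z := fun z => by
    ext v; simp [hg]
  have hinv : ContDiffAt ℝ 1 (fun z => ‖g z‖⁻¹) c :=
    (hgC.norm ℝ hg0).inv (norm_ne_zero_iff.2 hg0)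
  have hn : ContDiffAt ℝ 1 (fun z => ‖g z‖⁻¹ • g z) c := hinv.smul hgC
  have hg0' : ∀ᶠ z in 𝓝 c, g z ≠ 0 := hgC.continuousAt.eventually_ne hg0
  have hnorm : ∀ᶠ z in 𝓝 c, ⟪‖g z‖⁻¹ • g z, ‖g z‖⁻¹ • g z⟫ = 1 := by
    filter_upwards [hg0'] with z hz
    rw [real_inner_self_eq_norm_sq, norm_smul, norm_inv, norm_norm,
      inv_mul_cancel₀ (norm_ne_zero_iff.2 hz), one_pow]
  have hnd := (hn.differentiableAt (by norm_num)).hasFDerivAt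
  refine ⟨fun z => ‖g z‖⁻¹ • g z, hn, ?_, ?_, ?_⟩
  · have hρd : ∀ᶠ z in 𝓝 c, ContDiffAt ℝ 2 ρ z := hρ.eventually (by norm_num)
    filter_upwards [nhdsWithin_le_nhds hρd, nhdsWithin_le_nhds hg0',
      nhdsWithin_le_nhds hCρ.eventually_nhds, self_mem_nhdsWithin] with z h1 h2 h3 h4
    have hz := frontier_value_eq_zero hC.isCompact.isClosed h4 h1.continuousAt h3
    refine isOutwardUnitNormal_of_hasFDerivAt ?_ hz h2 ?_
    · rw [hginner]
      exact (h1.differentiableAt (by norm_num)).hasFDerivAt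
    · filter_upwards [h3] with y hy
      exact ⟨fun h => hy.2 h.le, fun h hyC => absurd (hy.1 hyC) (not_le.2 h)⟩
  · intro v
    have h1 := hnd.inner ℝ hnd
    have h2 := (hasFDerivAt_const (𝕜 := ℝ) (1 : ℝ) c).congr_of_eventuallyEq hnorm
    have h3 := congrArg (fun L : E →L[ℝ] ℝ => L v) (h1.unique h2)
    simp only [ContinuousLinearMap.comp_apply, fderivInnerCLM_apply,
      ContinuousLinearMap.prod_apply, zero_apply] at h3
    rw [real_inner_comm (fderiv ℝ _ c v)] at h3
    rw [real_inner_comm]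
    linarith
  · have hsymm : IsSymmSndFDerivAt ℝ ρ c := hρ.isSymmSndFDerivAt (by simp)
    have hgd : HasFDerivAt g ((InnerProductSpace.toDual ℝ E).symm.toContinuousLinearEquiv.toContinuousLinearMap
        ∘L fderiv ℝ (fderiv ℝ ρ) c) c := by
      have h1 : HasFDerivAt (fderiv ℝ ρ) (fderiv ℝ (fderiv ℝ ρ) c) c :=
        ((hρ.fderiv_right (m := 1) (by norm_num)).differentiableAt (by norm_num)).hasFDerivAt
      exact ((InnerProductSpace.toDual ℝ E).symm.toContinuousLinearEquiv.hasFDerivAt).comp c h1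
    have hinvd := (hinv.differentiableAt (by norm_num)).hasFDerivAt
    -- Differentiating the factor `‖g‖⁻¹` produces only a multiple of `g c`, which a tangent vector
    -- `w` does not see.
    have heq : ∀ v w, ⟪‖g c‖⁻¹ • g c, w⟫ = 0 →
        ⟪fderiv ℝ (fun z => ‖g z‖⁻¹ • g z) c v, w⟫ = ‖g c‖⁻¹ * fderiv ℝ (fderiv ℝ ρ) c v w := by
      intro v w hw
      have hw' : ⟪g c, w⟫ = 0 := by
        rw [inner_smul_left] at hw
        simpa [hg0] using hw
      have := (hinvd.smul hgd).fderiv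
      change fderiv ℝ (fun z => ‖g z‖⁻¹ • g z) c = _ at this
      rw [this]
      simp only [add_apply, smul_apply, ContinuousLinearMap.smulRight_apply,
        ContinuousLinearMap.comp_apply, inner_add_left, inner_smul_left, hw']
      simp
    intro v w hv hw
    rw [heq v w hw, heq w v hv, hsymm v w]

variable {C : Set (EuclideanSpace ℝ (Fin N))} {c : EuclideanSpace ℝ (Fin N)}

theorem IsConvexCore.isOutwardUnitNormal (hC : IsConvexCore C) (hc : c ∈ frontier C) :
    IsOutwardUnitNormal C c (outwardNormal C c) := by
  obtain ⟨n, -, h, -⟩ := hC.exists_normalField hc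
  have := h.self_of_nhdsWithin hc
  rwa [this.outwardNormal_eq]

theorem IsConvexCore.norm_outwardNormal (hC : IsConvexCore C) (hc : c ∈ frontier C) :
    ‖outwardNormal C c‖ = 1 := (hC.isOutwardUnitNormal hc).1

theorem eventually_outwardNormal_eq {n : E → E}
    (h : ∀ᶠ z in 𝓝[frontier C] c, IsOutwardUnitNormal C z (n z)) :
    outwardNormal C =ᶠ[𝓝[frontier C] c] n := h.mono fun _ hz => hz.outwardNormal_eq

theorem hasFDerivWithinAt_outwardNormal {n : E → E} (hc : c ∈ frontier C)
    (hn : ContDiffAt ℝ 1 n c)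
    (h : ∀ᶠ z in 𝓝[frontier C] c, IsOutwardUnitNormal C z (n z)) :
    HasFDerivWithinAt (outwardNormal C) (fderiv ℝ n c) (frontier C) c :=
  (hn.differentiableAt (by norm_num)).hasFDerivAt.hasFDerivWithinAt.congr_of_eventuallyEq
    (eventually_outwardNormal_eq h) (h.self_of_nhdsWithin hc).outwardNormal_eq

theorem shapeOperator_eq {n : E → E} (hc : c ∈ frontier C) (hn : ContDiffAt ℝ 1 n c)
    (h : ∀ᶠ z in 𝓝[frontier C] c, IsOutwardUnitNormal C z (n z)) :
    shapeOperator C c = -(fderiv ℝ n c ∘L tangentProj C c) := by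
  rw [shapeOperator, surfaceDeriv_eq_of_hasFDerivWithinAt (h.self_of_nhdsWithin hc)
    (hasFDerivWithinAt_outwardNormal hc hn h)]

theorem IsConvexCore.hasSurfaceDerivAt_outwardNormal (hC : IsConvexCore C) (hc : c ∈ frontier C) :
    HasSurfaceDerivAt C (outwardNormal C) (-shapeOperator C c) c := by
  obtain ⟨n, hn, h, -⟩ := hC.exists_normalField hc
  rw [shapeOperator, neg_neg]
  exact hasSurfaceDerivAt_surfaceDeriv (hC.isOutwardUnitNormal hc)
    (hasFDerivWithinAt_outwardNormal hc hn h).differentiableWithinAt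

theorem IsConvexCore.continuousWithinAt_outwardNormal (hC : IsConvexCore C)
    (hc : c ∈ frontier C) : ContinuousWithinAt (outwardNormal C) (frontier C) c :=
  (hC.hasSurfaceDerivAt_outwardNormal hc).1.continuousWithinAt

theorem IsConvexCore.shapeOperator_outwardNormal (hC : IsConvexCore C) (hc : c ∈ frontier C) :
    shapeOperator C c (outwardNormal C c) = 0 := by
  simpa using (hC.hasSurfaceDerivAt_outwardNormal hc).2

theorem IsConvexCore.inner_outwardNormal_shapeOperator (hC : IsConvexCore C)
    (hc : c ∈ frontier C) (v : E) : ⟪outwardNormal C c, shapeOperator C c v⟫ = 0 := by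
  obtain ⟨n, hn, h, h1, -⟩ := hC.exists_normalField hc
  rw [shapeOperator_eq hc hn h, (h.self_of_nhdsWithin hc).outwardNormal_eq]
  simp [h1]

theorem inner_tangentProj {ν : E} (h : IsOutwardUnitNormal C c ν) (v : E) :
    ⟪ν, tangentProj C c v⟫ = 0 := by
  rw [tangentProj_apply h, inner_sub_right, inner_smul_right, real_inner_self_eq_norm_sq, h.1]
  simp

theorem tangentProj_of_inner_eq_zero {ν : E} (h : IsOutwardUnitNormal C c ν) {v : E}
    (hv : ⟪ν, v⟫ = 0) : tangentProj C c v = v := by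
  rw [tangentProj_apply h, hv]; simp

theorem tangentProj_normal {ν : E} (h : IsOutwardUnitNormal C c ν) :
    tangentProj C c ν = 0 := by
  rw [tangentProj_apply h, real_inner_self_eq_norm_sq, h.1]; simp

theorem inner_tangentProj_right {ν : E} (h : IsOutwardUnitNormal C c ν) {v : E} (w : E)
    (hv : ⟪ν, v⟫ = 0) : ⟪v, tangentProj C c w⟫ = ⟪v, w⟫ := by
  rw [tangentProj_apply h, inner_sub_right, inner_smul_right, real_inner_comm ν v, hv]; simp

theorem IsConvexCore.shapeOperator_tangentProj (hC : IsConvexCore C) (hc : c ∈ frontier C)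
    (v : E) : shapeOperator C c (tangentProj C c v) = shapeOperator C c v := by
  rw [tangentProj_apply (hC.isOutwardUnitNormal hc), map_sub, map_smul,
    hC.shapeOperator_outwardNormal hc]; simp

theorem IsConvexCore.inner_shapeOperator (hC : IsConvexCore C) (hc : c ∈ frontier C) (v w : E) :
    ⟪shapeOperator C c v, w⟫ = ⟪v, shapeOperator C c w⟫ := by
  obtain ⟨n, hn, h, -, h2⟩ := hC.exists_normalField hc
  have hnc := h.self_of_nhdsWithin hc
  have e : ∀ v w, ⟪shapeOperator C c v, w⟫ =
      -⟪fderiv ℝ n c (tangentProj C c v), tangentProj C c w⟫ := by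
    intro v w
    have := hC.inner_outwardNormal_shapeOperator hc v
    rw [hnc.outwardNormal_eq] at this
    rw [← inner_tangentProj_right hnc w this, shapeOperator_eq hc hn h]
    simp
  rw [e, h2 _ _ (inner_tangentProj hnc v) (inner_tangentProj hnc w), ← e, real_inner_comm]

/-- A convex set lies behind its tangent hyperplanes. -/
theorem IsOutwardUnitNormal.inner_sub_nonpos {ν : E} (h : IsOutwardUnitNormal C c ν)
    (hC : Convex ℝ C) (hc : c ∈ C) {y : E} (hy : y ∈ C) : ⟪y - c, ν⟫ ≤ 0 := by
  by_contra! hlt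
  have h1 : ∀ᶠ t : ℝ in 𝓝[>] 0, t < 1 := nhdsWithin_le_nhds (gt_mem_nhds one_pos)
  obtain ⟨t, ⟨ht, ht1⟩, ht0⟩ :=
    (((h.eventually_notMem hlt).and h1).and self_mem_nhdsWithin).exists
  exact ht (hC.add_smul_sub_mem hc hy ⟨le_of_lt ht0, ht1.le⟩)

theorem IsConvexCore.mem_of_frontier (hC : IsConvexCore C) (hc : c ∈ frontier C) : c ∈ C :=
  hC.isCompact.isClosed.frontier_subset hc

theorem IsConvexCore.inner_sub_nonpos (hC : IsConvexCore C) (hc : c ∈ frontier C) {y : E}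
    (hy : y ∈ C) : ⟪y - c, outwardNormal C c⟫ ≤ 0 :=
  (hC.isOutwardUnitNormal hc).inner_sub_nonpos hC.convex (hC.mem_of_frontier hc) hy

/-- The supporting inequalities at two boundary points add up to monotonicity of the normal field.
Dividing by `t²` along a curve gives `Dν ≥ 0` on the tangent space, that is `S ≤ 0`. -/
theorem IsConvexCore.inner_shapeOperator_self_nonpos (hC : IsConvexCore C)
    (hc : c ∈ frontier C) (v : E) : ⟪shapeOperator C c v, v⟫ ≤ 0 := by
  have hn := hC.isOutwardUnitNormal hc
  have h0 : ⟪tangentProj C c v, outwardNormal C c⟫ = 0 := by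
    rw [real_inner_comm, inner_tangentProj hn]
  obtain ⟨γ, h1, h2, h3⟩ := hn.hasFDerivWithinAt_lim h0 (hC.hasSurfaceDerivAt_outwardNormal hc).1
  have h4 := h3.inner (𝕜 := ℝ) h2
  have h5 : 0 ≤ ⟪(-shapeOperator C c) (tangentProj C c v), tangentProj C c v⟫ := by
    refine ge_of_tendsto h4 ?_
    filter_upwards [h1] with t ht
    rw [inner_smul_left, inner_smul_right]
    have e1 := hC.inner_sub_nonpos hc (hC.mem_of_frontier ht)
    have e2 := hC.inner_sub_nonpos ht (hC.mem_of_frontier hc)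
    have e3 : ⟪outwardNormal C (c + γ t) - outwardNormal C c, γ t⟫ =
      -⟪c - (c + γ t), outwardNormal C (c + γ t)⟫ - ⟪c + γ t - c, outwardNormal C c⟫ := by
      rw [inner_sub_left, add_sub_cancel_left, sub_add_cancel_left, inner_neg_left,
        real_inner_comm (γ t), real_inner_comm (γ t)]
      ring
    have e4 : 0 ≤ ⟪outwardNormal C (c + γ t) - outwardNormal C c, γ t⟫ := by linarith
    simp only [conj_trivial]
    nlinarith [mul_self_nonneg t⁻¹]
  rw [neg_apply, inner_neg_left, hC.shapeOperator_tangentProj hc,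
    inner_tangentProj_right hn v (hC.inner_outwardNormal_shapeOperator hc v)] at h5
  linarith

/-- A single `C¹` extension `n` of the normal represents the shape operator at all nearby boundary
points, through `Dn` and the projection along `n`, both continuous. -/
theorem IsConvexCore.continuousWithinAt_shapeOperator (hC : IsConvexCore C)
    (hc : c ∈ frontier C) : ContinuousWithinAt (shapeOperator C) (frontier C) c := by
  obtain ⟨n, hn, h, -⟩ := hC.exists_normalField hc
  have h1 : ∀ᶠ z in 𝓝[frontier C] c, shapeOperator C z =
      -(fderiv ℝ n z ∘L (ContinuousLinearMap.id ℝ E - (innerSL ℝ (n z)).smulRight (n z))) := by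
    have h2 : ∀ᶠ z in 𝓝 c, ContDiffAt ℝ 1 n z := hn.eventually (by norm_num)
    filter_upwards [eventually_eventually_nhdsWithin.2 h, nhdsWithin_le_nhds h2,
      self_mem_nhdsWithin] with z hz hz2 hzC
    rw [shapeOperator_eq hzC hz2 hz, tangentProj_eq (hz.self_of_nhdsWithin hzC)]
  have hnc : ContinuousAt n c := hn.continuousAt
  have hdc : ContinuousAt (fderiv ℝ n) c := (hn.fderiv_right (m := 0) (by norm_num)).continuousAt
  have h3 : ContinuousAt (fun z => -(fderiv ℝ n z ∘L
      (ContinuousLinearMap.id ℝ E - (innerSL ℝ (n z)).smulRight (n z)))) c := by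
    refine (hdc.clm_comp (continuousAt_const.sub ?_)).neg
    have : Continuous fun ν : E => (innerSL ℝ ν).smulRight ν := by
      have h4 : Continuous fun p : (E →L[ℝ] ℝ) × E => p.1.smulRight p.2 := by
        fun_prop
      exact h4.comp ((innerSL ℝ).continuous.prodMk continuous_id)
    exact this.continuousAt.comp hnc
  exact h3.continuousWithinAt.congr_of_eventuallyEq h1 (h1.self_of_nhdsWithin hc)

end

section

/-! ### The inverse of `I - t S` -/

/-- Coercivity gives injectivity, which in finite dimension is enough. -/
theorem isInvertible_of_norm_sq_le_inner {B : E →L[ℝ] E} (h : ∀ v, ‖v‖ ^ 2 ≤ ⟪B v, v⟫) :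
    B.IsInvertible := by
  have hinj : Function.Injective (B : E →ₗ[ℝ] E) := by
    rw [← LinearMap.ker_eq_bot, LinearMap.ker_eq_bot']
    intro v hv
    have h1 := h v
    rw [show B v = 0 from hv, inner_zero_left] at h1
    exact norm_eq_zero.1 (pow_eq_zero_iff (two_ne_zero)|>.1 (le_antisymm h1 (sq_nonneg _)))
  refine ⟨(LinearEquiv.ofInjectiveEndo (B : E →ₗ[ℝ] E) hinj).toContinuousLinearEquiv, ?_⟩
  ext1 v
  rfl

variable {C : Set (EuclideanSpace ℝ (Fin N))} {c : EuclideanSpace ℝ (Fin N)}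

/-- The operator `(I - t S_c)⁻¹`. -/
noncomputable def parallelInverse (C : Set E) (c : E) (t : ℝ) : E →L[ℝ] E :=
  (ContinuousLinearMap.id ℝ E - t • shapeOperator C c).inverse

theorem IsConvexCore.norm_sq_le_inner (hC : IsConvexCore C) (hc : c ∈ frontier C) {t : ℝ}
    (ht : 0 ≤ t) (v : E) :
    ‖v‖ ^ 2 ≤ ⟪(ContinuousLinearMap.id ℝ E - t • shapeOperator C c) v, v⟫ := by
  have := hC.inner_shapeOperator_self_nonpos hc v
  simp only [sub_apply, ContinuousLinearMap.id_apply, smul_apply, inner_sub_left, inner_smul_left,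
    real_inner_self_eq_norm_sq, conj_trivial]
  nlinarith

theorem IsConvexCore.isInvertible (hC : IsConvexCore C) (hc : c ∈ frontier C) {t : ℝ}
    (ht : 0 ≤ t) : (ContinuousLinearMap.id ℝ E - t • shapeOperator C c).IsInvertible :=
  isInvertible_of_norm_sq_le_inner (hC.norm_sq_le_inner hc ht)

theorem IsConvexCore.parallelInverse_apply_sub (hC : IsConvexCore C) (hc : c ∈ frontier C) {t : ℝ}
    (ht : 0 ≤ t) (v : E) : parallelInverse C c t (v - t • shapeOperator C c v) = v := by
  have := (hC.isInvertible hc ht).inverse_apply_self v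
  exact this

theorem IsConvexCore.parallelInverse_sub (hC : IsConvexCore C) (hc : c ∈ frontier C) {t : ℝ}
    (ht : 0 ≤ t) (v : E) :
    parallelInverse C c t v - t • shapeOperator C c (parallelInverse C c t v) = v := by
  have := (hC.isInvertible hc ht).self_apply_inverse v
  exact this

/-- As `S ≤ 0`, `I - tS` is coercive with constant one. The bound, uniform in the point and in `t`,
later keeps the normals of a tube with small gradient close to those of the core. -/
theorem IsConvexCore.norm_parallelInverse_le (hC : IsConvexCore C) (hc : c ∈ frontier C) {t : ℝ}
    (ht : 0 ≤ t) (v : E) : ‖parallelInverse C c t v‖ ≤ ‖v‖ := by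
  have h1 := hC.norm_sq_le_inner hc ht (parallelInverse C c t v)
  have h2 := hC.parallelInverse_sub hc ht v
  simp only [sub_apply, ContinuousLinearMap.id_apply, smul_apply] at h1
  rw [h2] at h1
  have h3 := real_inner_le_norm v (parallelInverse C c t v)
  by_contra! hlt
  nlinarith [norm_nonneg v]

theorem IsConvexCore.parallelInverse_outwardNormal (hC : IsConvexCore C) (hc : c ∈ frontier C)
    {t : ℝ} (ht : 0 ≤ t) : parallelInverse C c t (outwardNormal C c) = outwardNormal C c := by
  have := hC.parallelInverse_apply_sub hc ht (outwardNormal C c)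
  rwa [hC.shapeOperator_outwardNormal hc, smul_zero, sub_zero] at this

theorem IsConvexCore.inner_parallelInverse (hC : IsConvexCore C) (hc : c ∈ frontier C) {t : ℝ}
    (ht : 0 ≤ t) (v w : E) :
    ⟪parallelInverse C c t v, w⟫ = ⟪v, parallelInverse C c t w⟫ := by
  conv_lhs => rw [← hC.parallelInverse_sub hc ht w]
  conv_rhs => rw [← hC.parallelInverse_sub hc ht v]
  rw [inner_sub_left, inner_sub_right, inner_smul_left, inner_smul_right,
    hC.inner_shapeOperator hc]
  simp

theorem IsConvexCore.inner_outwardNormal_parallelInverse (hC : IsConvexCore C)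
    (hc : c ∈ frontier C) {t : ℝ} (ht : 0 ≤ t) (v : E) :
    ⟪outwardNormal C c, parallelInverse C c t v⟫ = ⟪outwardNormal C c, v⟫ := by
  rw [← hC.inner_parallelInverse hc ht, hC.parallelInverse_outwardNormal hc ht]

/-! ### The nearest point map -/

open Classical in
/-- The nearest point of a closed convex set. -/
noncomputable def nearestPoint (C : Set E) (y : E) : E :=
  if h : ∃ p ∈ C, ∀ z ∈ C, ⟪y - p, z - p⟫ ≤ 0 then h.choose else 0

/-- The distance to a closed convex set. -/
noncomputable def height (C : Set E) (y : E) : ℝ := ‖y - nearestPoint C y‖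

theorem IsConvexCore.nearestPoint_spec (hC : IsConvexCore C) (y : E) :
    nearestPoint C y ∈ C ∧ ∀ z ∈ C, ⟪y - nearestPoint C y, z - nearestPoint C y⟫ ≤ 0 := by
  have h : ∃ p ∈ C, ∀ z ∈ C, ⟪y - p, z - p⟫ ≤ 0 := by
    obtain ⟨p, hp, hp'⟩ := exists_norm_eq_iInf_of_complete_convex
      (hC.interior_nonempty.mono interior_subset) hC.isCompact.isClosed.isComplete hC.convex y
    exact ⟨p, hp, (norm_eq_iInf_iff_real_inner_le_zero hC.convex hp).1 hp'⟩
  rw [nearestPoint, dif_pos h]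
  exact h.choose_spec

/-- Adding the two variational inequalities gives `‖p - p'‖² ≤ ⟪y - y', p - p'⟫`. This yields both
uniqueness of the nearest point (`y = y'`) and the Lipschitz constant one. -/
theorem norm_sub_le_of_inner_nonpos {y y' p p' : E} (h : ⟪y - p, p' - p⟫ ≤ 0)
    (h' : ⟪y' - p', p - p'⟫ ≤ 0) : ‖p - p'‖ ≤ ‖y - y'‖ := by
  have h1 : ‖p - p'‖ ^ 2 ≤ ⟪y - y', p - p'⟫ := by
    have e1 : ⟪y - y', p - p'⟫ = ‖p - p'‖ ^ 2 - ⟪y - p, p' - p⟫ - ⟪y' - p', p - p'⟫ := by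
      rw [← real_inner_self_eq_norm_sq, ← neg_sub p p', inner_neg_right, sub_neg_eq_add,
        ← inner_add_left, ← inner_sub_left]
      congr 1
      abel
    linarith
  have h2 := real_inner_le_norm (y - y') (p - p')
  by_contra! hlt
  nlinarith [norm_nonneg (y - y')]

theorem IsConvexCore.nearestPoint_eq (hC : IsConvexCore C) {y p : E} (hp : p ∈ C)
    (h : ∀ z ∈ C, ⟪y - p, z - p⟫ ≤ 0) : nearestPoint C y = p := by
  obtain ⟨h1, h2⟩ := hC.nearestPoint_spec y
  have := norm_sub_le_of_inner_nonpos (h2 p hp) (h _ h1)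
  rw [sub_self, norm_zero] at this
  exact sub_eq_zero.1 (norm_le_zero_iff.1 this)

theorem IsConvexCore.nearestPoint_mem (hC : IsConvexCore C) (y : E) : nearestPoint C y ∈ C :=
  (hC.nearestPoint_spec y).1

theorem IsConvexCore.nearestPoint_of_mem (hC : IsConvexCore C) {y : E} (hy : y ∈ C) :
    nearestPoint C y = y := hC.nearestPoint_eq hy (by simp)

theorem IsConvexCore.norm_nearestPoint_sub_le (hC : IsConvexCore C) (y y' : E) :
    ‖nearestPoint C y - nearestPoint C y'‖ ≤ ‖y - y'‖ :=
  norm_sub_le_of_inner_nonpos ((hC.nearestPoint_spec y).2 _ (hC.nearestPoint_mem y'))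
    ((hC.nearestPoint_spec y').2 _ (hC.nearestPoint_mem y))

theorem IsConvexCore.continuous_nearestPoint (hC : IsConvexCore C) :
    Continuous (nearestPoint C) := by
  refine (LipschitzWith.of_dist_le_mul (K := 1) fun y y' => ?_).continuous
  simpa [dist_eq_norm] using hC.norm_nearestPoint_sub_le y y'

theorem IsConvexCore.continuous_height (hC : IsConvexCore C) : Continuous (height C) :=
  (continuous_id.sub hC.continuous_nearestPoint).norm

theorem IsConvexCore.height_pos (hC : IsConvexCore C) {y : E} (hy : y ∉ C) : 0 < height C y :=
  norm_pos_iff.2 fun h => hy (by rw [sub_eq_zero.1 h]; exact hC.nearestPoint_mem y)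

theorem IsConvexCore.height_of_mem (hC : IsConvexCore C) {y : E} (hy : y ∈ C) :
    height C y = 0 := by rw [height, hC.nearestPoint_of_mem hy, sub_self, norm_zero]

theorem IsConvexCore.nearestPoint_ray (hC : IsConvexCore C) (hc : c ∈ frontier C) {t : ℝ}
    (ht : 0 ≤ t) : nearestPoint C (c + t • outwardNormal C c) = c := by
  refine hC.nearestPoint_eq (hC.mem_of_frontier hc) fun z hz => ?_
  rw [add_sub_cancel_left, inner_smul_left, real_inner_comm]
  exact mul_nonpos_of_nonneg_of_nonpos ht (hC.inner_sub_nonpos hc hz)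

theorem IsConvexCore.height_ray (hC : IsConvexCore C) (hc : c ∈ frontier C) {t : ℝ}
    (ht : 0 ≤ t) : height C (c + t • outwardNormal C c) = t := by
  rw [height, hC.nearestPoint_ray hc ht, add_sub_cancel_left, norm_smul,
    hC.norm_outwardNormal hc, mul_one, Real.norm_of_nonneg ht]

theorem IsConvexCore.ray_notMem (hC : IsConvexCore C) (hc : c ∈ frontier C) {t : ℝ}
    (ht : 0 < t) : c + t • outwardNormal C c ∉ C := fun h => by
  have := hC.height_of_mem h
  rw [hC.height_ray hc ht.le] at this
  exact ht.ne' this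

/-- From an interior nearest point one could step towards `y` within `C`, against the variational
inequality. -/
theorem IsConvexCore.nearestPoint_mem_frontier (hC : IsConvexCore C) {y : E} (hy : y ∉ C) :
    nearestPoint C y ∈ frontier C := by
  refine ⟨subset_closure (hC.nearestPoint_mem y), fun hint => ?_⟩
  have h1 := eventually_ray (u := y - nearestPoint C y) (mem_interior_iff_mem_nhds.1 hint)
  obtain ⟨t, ht, ht0⟩ := (h1.and self_mem_nhdsWithin).exists
  have h2 := (hC.nearestPoint_spec y).2 _ ht
  rw [add_sub_cancel_left, inner_smul_right, real_inner_self_eq_norm_sq] at h2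
  have h3 := hC.height_pos hy
  have h4 : 0 < t * height C y ^ 2 := mul_pos ht0 (by positivity)
  exact absurd h2 (not_le.2 h4)

/-- If the supporting direction `u` differed from `ν`, then `u - ν` would point into `C` and yet
have positive product with `u`. -/
theorem IsOutwardUnitNormal.eq_of_inner_nonpos {ν u : E} (h : IsOutwardUnitNormal C c ν)
    (hu : ‖u‖ = 1) (hC : ∀ z ∈ C, ⟪u, z - c⟫ ≤ 0) : u = ν := by
  by_contra hne
  have h1 := inner_lt_one_of_ne hu h.1 hne
  have e1 : ⟪u - ν, ν⟫ < 0 := by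
    rw [inner_sub_left, real_inner_self_eq_norm_sq, h.1]; linarith
  obtain ⟨t, ht, ht0⟩ := ((h.eventually_mem e1).and self_mem_nhdsWithin).exists
  have h2 := hC _ ht
  rw [add_sub_cancel_left, inner_smul_right, inner_sub_right, real_inner_self_eq_norm_sq, hu] at h2
  have : 0 < t * (1 ^ 2 - ⟪u, ν⟫) := mul_pos ht0 (by linarith)
  linarith

theorem IsConvexCore.sub_nearestPoint (hC : IsConvexCore C) {y : E} (hy : y ∉ C) :
    y - nearestPoint C y = height C y • outwardNormal C (nearestPoint C y) := by
  have hpos := hC.height_pos hy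
  have h := (hC.isOutwardUnitNormal (hC.nearestPoint_mem_frontier hy)).eq_of_inner_nonpos
    (u := (height C y)⁻¹ • (y - nearestPoint C y)) ?_ fun z hz => ?_
  · rw [← h, smul_smul, mul_inv_cancel₀ hpos.ne', one_smul]
  · rw [norm_smul, norm_inv, Real.norm_of_nonneg hpos.le]
    exact inv_mul_cancel₀ hpos.ne'
  · rw [inner_smul_left]
    exact mul_nonpos_of_nonneg_of_nonpos (inv_nonneg.2 hpos.le) ((hC.nearestPoint_spec y).2 z hz)

theorem IsConvexCore.eq_ray (hC : IsConvexCore C) {y : E} (hy : y ∉ C) :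
    y = nearestPoint C y + height C y • outwardNormal C (nearestPoint C y) := by
  rw [← hC.sub_nearestPoint hy]; abel

/-- The distance to a convex set lies above its tangent functions. -/
theorem IsConvexCore.height_add_inner_le (hC : IsConvexCore C) {y : E} (hy : y ∉ C) (y' : E) :
    height C y + ⟪outwardNormal C (nearestPoint C y), y' - y⟫ ≤ height C y' := by
  have hf := hC.nearestPoint_mem_frontier hy
  have h1 := real_inner_le_norm (outwardNormal C (nearestPoint C y)) (y' - nearestPoint C y')
  rw [hC.norm_outwardNormal hf, one_mul] at h1
  refine le_trans ?_ h1
  have h2 := hC.inner_sub_nonpos hf (hC.nearestPoint_mem y')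
  have h3 : y' - nearestPoint C y' = (y' - y) + (y - nearestPoint C y) -
    (nearestPoint C y' - nearestPoint C y) := by abel
  rw [real_inner_comm] at h2
  rw [h3, inner_sub_right _ (_ + _), inner_add_right, hC.sub_nearestPoint hy, inner_smul_right,
    real_inner_self_eq_norm_sq, hC.norm_outwardNormal hf]
  linarith

theorem IsConvexCore.tendsto_nearestPoint (hC : IsConvexCore C) {y : E} (hy : y ∉ C) :
    Tendsto (nearestPoint C) (𝓝 y) (𝓝[frontier C] (nearestPoint C y)) := by
  refine tendsto_nhdsWithin_iff.2 ⟨hC.continuous_nearestPoint.continuousAt, ?_⟩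
  filter_upwards [hC.isCompact.isClosed.isOpen_compl.mem_nhds hy] with z hz
  exact hC.nearestPoint_mem_frontier hz

theorem IsConvexCore.continuousAt_outwardNormal_nearestPoint (hC : IsConvexCore C) {y : E}
    (hy : y ∉ C) : ContinuousAt (fun z => outwardNormal C (nearestPoint C z)) y :=
  (hC.continuousWithinAt_outwardNormal (hC.nearestPoint_mem_frontier hy)).tendsto.comp
    (hC.tendsto_nearestPoint hy)

/-- The tangent inequalities at `y` and at `z` trap the remainder between `0` and `⟪ν(P z) - ν(P y),
z - y⟫`, which is small by continuity of the normal. -/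
theorem IsConvexCore.hasFDerivAt_height (hC : IsConvexCore C) {y : E} (hy : y ∉ C) :
    HasFDerivAt (height C) (innerSL ℝ (outwardNormal C (nearestPoint C y))) y := by
  rw [hasFDerivAt_iff_isLittleO, Asymptotics.isLittleO_iff]
  intro ε hε
  have h1 := Metric.tendsto_nhds.1 (hC.continuousAt_outwardNormal_nearestPoint hy) ε hε
  filter_upwards [h1, hC.isCompact.isClosed.isOpen_compl.mem_nhds hy] with z hz hzC
  have h2 := hC.height_add_inner_le hy z
  have h3 := hC.height_add_inner_le hzC y
  rw [dist_eq_norm] at hz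
  have h4 := real_inner_le_norm (outwardNormal C (nearestPoint C z) -
    outwardNormal C (nearestPoint C y)) (z - y)
  have h5 : ⟪outwardNormal C (nearestPoint C z), y - z⟫ =
    -⟪outwardNormal C (nearestPoint C z), z - y⟫ := by rw [← inner_neg_right, neg_sub]
  rw [inner_sub_left] at h4
  rw [innerSL_apply_apply, Real.norm_eq_abs, abs_le]
  have h6 := mul_le_mul_of_nonneg_right hz.le (norm_nonneg (z - y))
  have h7 : 0 ≤ ε * ‖z - y‖ := by positivity
  constructor <;> linarith

/-- Differentiate the identity `z = P z + h(z) ν(P z)` implicitly: `dz = (I - tS) dP + dh ν`.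
Projecting removes the last term and `M` inverts the first factor. -/
theorem IsConvexCore.hasFDerivAt_nearestPoint (hC : IsConvexCore C) {y : E} (hy : y ∉ C) :
    HasFDerivAt (nearestPoint C) (parallelInverse C (nearestPoint C y) (height C y) ∘L
      tangentProj C (nearestPoint C y)) y := by
  set c := nearestPoint C y with hcdef
  set t := height C y with htdef
  set ν := outwardNormal C c with hν
  have hc : c ∈ frontier C := hC.nearestPoint_mem_frontier hy
  have ht : 0 ≤ t := (hC.height_pos hy).le
  have hn := hC.isOutwardUnitNormal hc
  have hP := hC.tendsto_nearestPoint hy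
  -- Since `P` is Lipschitz, errors that are small relative to `P z - c` are small relative to `z -
  -- y`, before `P` is known to be differentiable.
  have hPO : (fun z => nearestPoint C z - c) =O[𝓝 y] fun z => z - y :=
    Asymptotics.IsBigO.of_bound 1 (Eventually.of_forall fun z => by
      rw [one_mul]; exact hC.norm_nearestPoint_sub_le z y)
  have hr1 : (fun z => outwardNormal C (nearestPoint C z) - ν -
      (-shapeOperator C c) (nearestPoint C z - c)) =o[𝓝 y] fun z => z - y :=
    (((hC.hasSurfaceDerivAt_outwardNormal hc).1.isLittleO).comp_tendsto hP).trans_isBigO hPO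
  have hr2 : (fun z => ⟪nearestPoint C z - c, ν⟫ • ν) =o[𝓝 y] fun z => z - y := by
    refine Asymptotics.IsBigO.trans_isLittleO ?_
      ((hn.isLittleO_inner.comp_tendsto hP).trans_isBigO hPO)
    refine Asymptotics.IsBigO.of_bound 1 (Eventually.of_forall fun z => ?_)
    rw [norm_smul, hn.1, mul_one, one_mul]; rfl
  have hr3 : (fun z => (height C z - t) • (outwardNormal C (nearestPoint C z) - ν))
      =o[𝓝 y] fun z => z - y := by
    have h1 := (hC.hasFDerivAt_height hy).isBigO_sub
    have h2 : (fun z => outwardNormal C (nearestPoint C z) - ν) =o[𝓝 y] fun _ => (1 : ℝ) := by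
      rw [Asymptotics.isLittleO_one_iff]
      have := (hC.continuousAt_outwardNormal_nearestPoint hy).tendsto.sub_const ν
      rwa [sub_self] at this
    have h3 := h1.norm_right.smul_isLittleO h2
    refine (h3.congr_right fun z => ?_).of_norm_right
    rw [smul_eq_mul, mul_one]
  set M := parallelInverse C c t with hM
  have hfin : (fun z => ⟪nearestPoint C z - c, ν⟫ • ν - (M ∘L tangentProj C c)
      (t • (outwardNormal C (nearestPoint C z) - ν - (-shapeOperator C c) (nearestPoint C z - c)) +
        (height C z - t) • (outwardNormal C (nearestPoint C z) - ν)))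
        =o[𝓝 y] fun z => z - y :=
    hr2.sub (((M ∘L tangentProj C c).isBigO_comp _ _).trans_isLittleO
      ((hr1.const_smul_left t).add hr3))
  rw [hasFDerivAt_iff_isLittleO]
  refine hfin.congr' ?_ EventuallyEq.rfl
  filter_upwards [hC.isCompact.isClosed.isOpen_compl.mem_nhds hy] with z hz
  set p := nearestPoint C z
  set νz := outwardNormal C p
  have e1 : z - y = (p - c - t • shapeOperator C c (p - c)) + (height C z - t) • ν +
      (t • (νz - ν - (-shapeOperator C c) (p - c)) + (height C z - t) • (νz - ν)) := by
    conv_lhs => rw [hC.eq_ray hz, hC.eq_ray hy]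
    rw [neg_apply]
    module
  have e2 : (M ∘L tangentProj C c) ((p - c - t • shapeOperator C c (p - c)) +
      (height C z - t) • ν) = p - c - ⟪p - c, ν⟫ • ν := by
    rw [map_add, map_smul, ContinuousLinearMap.comp_apply, ContinuousLinearMap.comp_apply,
      tangentProj_normal hn, map_zero, smul_zero, add_zero, tangentProj_apply hn, map_sub,
      hC.parallelInverse_apply_sub hc ht, map_smul, hC.parallelInverse_outwardNormal hc ht,
      inner_sub_right, inner_smul_right, hC.inner_outwardNormal_shapeOperator hc, mul_zero,
      sub_zero, real_inner_comm]
  rw [e1, map_add (M ∘L tangentProj C c) _ (t • _ + _), e2]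
  change _ = p - c - _
  abel

end

variable {C Ω : Set (EuclideanSpace ℝ (Fin N))} {c : EuclideanSpace ℝ (Fin N)}

/-! ### Gradients along the boundary of a core -/

theorem inner_surfaceGrad (f : E → ℝ) (v : E) : ⟪surfaceGrad C f c, v⟫ = surfaceDeriv C f c v := by
  rw [surfaceGrad, InnerProductSpace.toDual_symm_apply]

theorem surfaceGrad_eq_of_hasFDerivWithinAt {ν : E} (h : IsOutwardUnitNormal C c ν) {f : E → ℝ}
    {L : E →L[ℝ] ℝ} (hf : HasFDerivWithinAt f L (frontier C) c) :
    surfaceGrad C f c = tangentProj C c ((InnerProductSpace.toDual ℝ E).symm L) := by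
  refine ext_inner_right ℝ fun v => ?_
  rw [inner_surfaceGrad, surfaceDeriv_eq_of_hasFDerivWithinAt h hf, tangentProj_apply h,
    ContinuousLinearMap.comp_apply, tangentProj_apply h, inner_sub_left, inner_smul_left,
    InnerProductSpace.toDual_symm_apply, map_sub, map_smul,
    real_inner_comm ((InnerProductSpace.toDual ℝ E).symm L) ν,
    InnerProductSpace.toDual_symm_apply]
  simp [mul_comm]

theorem inner_normal_surfaceGrad {ν : E} (h : IsOutwardUnitNormal C c ν) {f : E → ℝ}
    (hf : DifferentiableWithinAt ℝ f (frontier C) c) : ⟪ν, surfaceGrad C f c⟫ = 0 := by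
  rw [surfaceGrad_eq_of_hasFDerivWithinAt h hf.hasFDerivWithinAt, inner_tangentProj h]

/-- On the boundary the gradient is the tangential part of a `C¹` ambient derivative of `f`, and the
projection varies differentiably because `ν` does. -/
theorem IsConvexCore.differentiableWithinAt_surfaceGrad (hC : IsConvexCore C)
    (hc : c ∈ frontier C) {f : E → ℝ} (hf : ContDiffWithinAt ℝ 2 f (frontier C) c) :
    DifferentiableWithinAt ℝ (surfaceGrad C f) (frontier C) c := by
  obtain ⟨u, hu, -, -, f', hf', hf'C⟩ :=
    (contDiffWithinAt_succ_iff_hasFDerivWithinAt' (n := 1) (by norm_num)).1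
      (by rw [one_add_one_eq_two]; exact hf)
  rw [insert_eq_of_mem hc] at hu
  set g : E → E := fun z => (InnerProductSpace.toDual ℝ E).symm (f' z) with hg
  have hgd : DifferentiableWithinAt ℝ g (frontier C) c :=
    (InnerProductSpace.toDual ℝ E).symm.toContinuousLinearEquiv.differentiableAt.comp_differentiableWithinAt
      c (hf'C.differentiableWithinAt (by norm_num))
  have hν := (hC.hasSurfaceDerivAt_outwardNormal hc).1.differentiableWithinAt
  have h1 : ∀ z ∈ u ∩ frontier C,
      surfaceGrad C f z = g z - ⟪outwardNormal C z, g z⟫ • outwardNormal C z := fun z hz => by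
    rw [surfaceGrad_eq_of_hasFDerivWithinAt (hC.isOutwardUnitNormal hz.2) (hf' z hz.1),
      tangentProj_apply (hC.isOutwardUnitNormal hz.2)]
  refine DifferentiableWithinAt.congr_of_eventuallyEq (hgd.sub ((hν.inner ℝ hgd).smul hν)) ?_
    (h1 c ⟨mem_of_mem_nhdsWithin hc hu, hc⟩)
  filter_upwards [hu, self_mem_nhdsWithin] with z hz hz'
  exact h1 z ⟨hz, hz'⟩

/-- At a critical point the derivative of the gradient field is tangential. -/
theorem IsConvexCore.surfaceHess_eq (hC : IsConvexCore C) (hc : c ∈ frontier C) {f : E → ℝ}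
    (hf : ContDiffOn ℝ 2 f (frontier C)) (hcrit : surfaceGrad C f c = 0) :
    surfaceHess C f c = surfaceDeriv C (surfaceGrad C f) c := by
  have hn := hC.isOutwardUnitNormal hc
  have hg := hasSurfaceDerivAt_surfaceDeriv hn
    (hC.differentiableWithinAt_surfaceGrad hc (hf c hc))
  -- Differentiate `⟪ν, grad f⟫ = 0`; at a critical point only `⟪ν, D(grad f)⟫` survives.
  have h1 := (hC.hasSurfaceDerivAt_outwardNormal hc).1.inner ℝ hg.1
  have h0 : HasFDerivWithinAt (fun z => ⟪outwardNormal C z, surfaceGrad C f z⟫) (0 : E →L[ℝ] ℝ)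
      (frontier C) c := by
    refine (hasFDerivWithinAt_const (0 : ℝ) c _).congr (fun z hz => ?_) ?_
    · exact inner_normal_surfaceGrad (hC.isOutwardUnitNormal hz)
        ((hf z hz).differentiableWithinAt (by norm_num))
    · rw [hcrit, inner_zero_right]
  have h2 := (hasSurfaceDerivAt_comp_tangentProj hn h1).unique hn
    (hasSurfaceDerivAt_comp_tangentProj hn h0)
  ext1 v
  have h3 := congrArg (fun L : E →L[ℝ] ℝ => L v) h2
  simp only [ContinuousLinearMap.comp_apply, fderivInnerCLM_apply,
    ContinuousLinearMap.prod_apply, zero_apply, hcrit, inner_zero_right, add_zero] at h3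
  rw [surfaceHess, ContinuousLinearMap.comp_apply]
  apply tangentProj_of_inner_eq_zero hn
  rw [tangentProj_apply hn, map_sub, map_smul, hg.2, smul_zero, sub_zero] at h3
  exact h3

/-! ### The normal of a domain given by its thickness -/

/-- An outward normal vector, at `c + d(c) ν(c)`, of the hypersurface of thickness `d`. -/
noncomputable def radialCovector (C : Set E) (d : E → ℝ) (c : E) : E :=
  outwardNormal C c - parallelInverse C c (d c) (surfaceGrad C d c)

theorem IsConvexCore.inner_radialCovector (hC : IsConvexCore C) (hc : c ∈ frontier C) {d : E → ℝ}
    (hd : DifferentiableWithinAt ℝ d (frontier C) c) (hpos : 0 < d c) :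
    ⟪outwardNormal C c, radialCovector C d c⟫ = 1 := by
  have hn := hC.isOutwardUnitNormal hc
  rw [radialCovector, inner_sub_right, hC.inner_outwardNormal_parallelInverse hc hpos.le,
    inner_normal_surfaceGrad hn hd, real_inner_self_eq_norm_sq, hn.1]
  norm_num

theorem IsConvexCore.radialCovector_ne_zero (hC : IsConvexCore C) (hc : c ∈ frontier C)
    {d : E → ℝ} (hd : DifferentiableWithinAt ℝ d (frontier C) c) (hpos : 0 < d c) :
    radialCovector C d c ≠ 0 := fun h => by
  have := hC.inner_radialCovector hc hd hpos
  rw [h, inner_zero_right] at this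
  exact zero_ne_one this

/-- Chain rule; the self-adjointness of `M` moves it from the increment to the gradient. -/
theorem IsConvexCore.hasFDerivAt_comp_nearestPoint (hC : IsConvexCore C) {x : E} (hx : x ∉ C)
    {f : E → ℝ} (hf : DifferentiableWithinAt ℝ f (frontier C) (nearestPoint C x)) :
    HasFDerivAt (fun y => f (nearestPoint C y)) (innerSL ℝ (parallelInverse C (nearestPoint C x)
      (height C x) (surfaceGrad C f (nearestPoint C x)))) x := by
  have hc := hC.nearestPoint_mem_frontier hx
  have hn := hC.isOutwardUnitNormal hc
  have hpos := hC.height_pos hx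
  have hPd := hC.hasFDerivAt_nearestPoint hx
  have h1 := (hasSurfaceDerivAt_surfaceDeriv hn hf).1
  have hdd : HasFDerivAt (fun y => f (nearestPoint C y)) (surfaceDeriv C f (nearestPoint C x) ∘L
      (parallelInverse C (nearestPoint C x) (height C x) ∘L
        tangentProj C (nearestPoint C x))) x := by
    rw [hasFDerivAt_iff_isLittleO]
    have h0 : (fun y => nearestPoint C y - nearestPoint C x) =O[𝓝 x] fun y => y - x :=
      Asymptotics.IsBigO.of_bound 1 (Eventually.of_forall fun z => by
        rw [one_mul]; exact hC.norm_nearestPoint_sub_le z x)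
    have h2 := (h1.isLittleO.comp_tendsto (hC.tendsto_nearestPoint hx)).trans_isBigO h0
    have h3 := ((surfaceDeriv C f (nearestPoint C x)).isBigO_comp _ _).trans_isLittleO
      hPd.isLittleO
    refine (h2.add h3).congr_left fun y => ?_
    simp only [Function.comp_apply, ContinuousLinearMap.comp_apply, map_sub]
    abel
  refine hdd.congr_fderiv ?_
  ext1 v
  have h4 : ⟪outwardNormal C (nearestPoint C x), parallelInverse C (nearestPoint C x)
      (height C x) (surfaceGrad C f (nearestPoint C x))⟫ = 0 := by
    rw [hC.inner_outwardNormal_parallelInverse hc hpos.le, inner_normal_surfaceGrad hn hf]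
  rw [innerSL_apply_apply, ContinuousLinearMap.comp_apply, ContinuousLinearMap.comp_apply,
    ← inner_surfaceGrad, ← hC.inner_parallelInverse hc hpos.le, inner_tangentProj_right hn v h4]

theorem IsConvexCore.isOutwardUnitNormal_radial (hC : IsConvexCore C) (hc : c ∈ frontier C)
    {d : E → ℝ} (hd : DifferentiableWithinAt ℝ d (frontier C) c) (hpos : 0 < d c)
    (hΩ : ∀ y ∉ C, y ∈ Ω ↔ height C y < d (nearestPoint C y)) :
    IsOutwardUnitNormal Ω (c + d c • outwardNormal C c)
      (‖radialCovector C d c‖⁻¹ • radialCovector C d c) := by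
  set x := c + d c • outwardNormal C c with hx
  have hxC : x ∉ C := hC.ray_notMem hc hpos
  have hPx : nearestPoint C x = c := hC.nearestPoint_ray hc hpos.le
  have hhx : height C x = d c := hC.height_ray hc hpos.le
  have hh := (hC.hasFDerivAt_height hxC).sub
    (hC.hasFDerivAt_comp_nearestPoint hxC (f := d) (by rwa [hPx]))
  refine isOutwardUnitNormal_of_hasFDerivAt (h := fun y => height C y - d (nearestPoint C y))
    ?_ ?_ (hC.radialCovector_ne_zero hc hd hpos) ?_
  · refine hh.congr_fderiv ?_
    rw [hPx, hhx, radialCovector, map_sub]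
  · simp only [hPx, hhx, sub_self]
  · filter_upwards [hC.isCompact.isClosed.isOpen_compl.mem_nhds hxC] with y hy
    rw [hΩ y hy]
    constructor
    · intro h; linarith
    · intro h; linarith

/-! ### The thickness of an admissible domain -/

/-- Connectedness of the ray section makes the set of radii an interval starting at `0`; openness of
`Ω` excludes its upper end. -/
theorem IsAdmissible.mem_ray_iff (hΩ : IsAdmissible C Ω) (hC : IsConvexCore C)
    (hc : c ∈ frontier C) {t : ℝ} (ht : 0 ≤ t) :
    c + t • outwardNormal C c ∈ Ω ↔ t < thickness C Ω c := by
  set A := {r : ℝ | 0 ≤ r ∧ c + r • outwardNormal C c ∈ Ω} with hA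
  have hbdd : BddAbove A := hΩ.finite_thickness c hc
  have h0 : (0 : ℝ) ∈ A := ⟨le_rfl, by
    rw [zero_smul, add_zero]; exact hΩ.normal_property.2.1 (hC.mem_of_frontier hc)⟩
  have himg : A = (fun y => ⟪y - c, outwardNormal C c⟫) '' (normalRay C c ∩ Ω) := by
    ext r
    constructor
    · rintro ⟨h1, h2⟩
      refine ⟨_, ⟨⟨r, h1, rfl⟩, h2⟩, ?_⟩
      simp only [add_sub_cancel_left, inner_smul_left, real_inner_self_eq_norm_sq,
        hC.norm_outwardNormal hc]
      simp
    · rintro ⟨_, ⟨⟨s, hs, rfl⟩, h2⟩, rfl⟩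
      simp only [add_sub_cancel_left, inner_smul_left, real_inner_self_eq_norm_sq,
        hC.norm_outwardNormal hc]
      refine ⟨by simpa using hs, by simpa using h2⟩
  have hord : A.OrdConnected := by
    rw [himg]
    exact ((hΩ.ray_connected c hc).isPreconnected.image _
      (by fun_prop : Continuous fun y : E => ⟪y - c, outwardNormal C c⟫).continuousOn).ordConnected
  change _ ↔ t < sSup A
  constructor
  · intro h
    have hcont : Continuous fun r : ℝ => c + r • outwardNormal C c := by fun_prop
    have h1 : ∀ᶠ r in 𝓝[>] t, c + r • outwardNormal C c ∈ Ω :=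
      nhdsWithin_le_nhds (hcont.continuousAt.eventually (hΩ.isOpen.mem_nhds h))
    obtain ⟨r, hr, hr'⟩ := (h1.and self_mem_nhdsWithin).exists
    exact lt_of_lt_of_le hr' (le_csSup hbdd ⟨ht.trans (le_of_lt hr'), hr⟩)
  · intro h
    obtain ⟨r, hr, hr'⟩ := exists_lt_of_lt_csSup ⟨0, h0⟩ h
    exact (hord.out h0 hr ⟨ht, hr'.le⟩).2

theorem IsAdmissible.thickness_pos (hΩ : IsAdmissible C Ω) (hC : IsConvexCore C)
    (hc : c ∈ frontier C) : 0 < thickness C Ω c := by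
  rw [← hΩ.mem_ray_iff hC hc le_rfl, zero_smul, add_zero]
  exact hΩ.normal_property.2.1 (hC.mem_of_frontier hc)

theorem IsAdmissible.mem_iff (hΩ : IsAdmissible C Ω) (hC : IsConvexCore C) {y : E} (hy : y ∉ C) :
    y ∈ Ω ↔ height C y < thickness C Ω (nearestPoint C y) := by
  conv_lhs => rw [hC.eq_ray hy]
  exact hΩ.mem_ray_iff hC (hC.nearestPoint_mem_frontier hy) (norm_nonneg _)

/-! ### The first hitting point -/

theorem IsOutwardUnitNormal.interior {ν : E} (h : IsOutwardUnitNormal C c ν) :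
    IsOutwardUnitNormal (interior C) c ν := by
  refine ⟨h.1, fun ε hε => ?_⟩
  filter_upwards [(h.2 ε hε).eventually_nhds] with y hy
  have hc1 : Continuous fun y : E => ⟪y - c, ν⟫ := by fun_prop
  have hc2 : Continuous fun y : E => -(ε * ‖y - c‖) := by fun_prop
  refine ⟨fun hlt => ?_, fun hlt hyC => hy.self_of_nhds.2 hlt (interior_subset hyC)⟩
  rw [mem_interior_iff_mem_nhds]
  filter_upwards [hy, hc1.continuousAt.eventually_lt hc2.continuousAt hlt] with z hz hz'
  exact hz.1 hz'

theorem firstHit_spec (hC : IsClosed C) {x n : E} (hx : x ∉ C)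
    (hne : ∃ t : ℝ, 0 ≤ t ∧ x + t • n ∈ C) :
    x + sInf {t : ℝ | 0 ≤ t ∧ x + t • n ∈ C} • n ∈ frontier C ∧
      ∀ t, 0 ≤ t → x + t • n ∈ C → sInf {t : ℝ | 0 ≤ t ∧ x + t • n ∈ C} ≤ t := by
  set A := {t : ℝ | 0 ≤ t ∧ x + t • n ∈ C} with hA
  have hcont : Continuous fun t : ℝ => x + t • n := by fun_prop
  have hbdd : BddBelow A := ⟨0, fun t ht => ht.1⟩
  have hcl : IsClosed A := isClosed_Ici.inter (hC.preimage hcont)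
  have hmem : sInf A ∈ A := hcl.csInf_mem hne hbdd
  refine ⟨⟨subset_closure hmem.2, fun hint => ?_⟩, fun t h1 h2 => csInf_le hbdd ⟨h1, h2⟩⟩
  have hpos : 0 < sInf A := by
    refine lt_of_le_of_ne hmem.1 fun h0 => hx ?_
    have := hmem.2
    rwa [← h0, zero_smul, add_zero] at this
  have h1 : ∀ᶠ t in 𝓝[<] (sInf A), x + t • n ∈ C :=
    nhdsWithin_le_nhds (hcont.continuousAt.eventually (mem_interior_iff_mem_nhds.1 hint))
  have h2 : ∀ᶠ t in 𝓝[<] (sInf A), 0 < t := nhdsWithin_le_nhds (lt_mem_nhds hpos)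
  obtain ⟨t, ⟨ht, ht0⟩, htlt⟩ := ((h1.and h2).and self_mem_nhdsWithin).exists
  exact absurd (csInf_le hbdd ⟨ht0.le, ht⟩) (not_le.2 htlt)

/-- The first hitting point of a convex core by a family of half-lines, transversal to the
boundary, depends differentiably on the parameter. -/
theorem IsConvexCore.hasFDerivWithinAt_firstHit (hC : IsConvexCore C) (hc : c ∈ frontier C)
    {x w q : E → E} {σ : E → ℝ} {d : ℝ} (hd : 0 ≤ d) {L : E →L[ℝ] E}
    (he : HasFDerivWithinAt (fun z => x z - d • w z) L (frontier C) c)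
    (hxc : x c - d • w c = c) (hw : ContinuousWithinAt w (frontier C) c)
    (hwc : w c = outwardNormal C c) (hL : ∀ v, ⟪outwardNormal C c, L v⟫ = 0)
    (hq : ∀ᶠ z in 𝓝[frontier C] c, (∃ s : ℝ, 0 ≤ s ∧ x z - s • w z ∈ C) →
      q z ∈ frontier C ∧ q z = x z - σ z • w z ∧
        ∀ s : ℝ, 0 ≤ s → x z - s • w z ∈ C → σ z ≤ s) :
    q c = c ∧ HasFDerivWithinAt q L (frontier C) c := by
  have hn := hC.isOutwardUnitNormal hc
  set ν := outwardNormal C c with hν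
  set e : E → E := fun z => x z - d • w z - c with hedef
  have het : Tendsto e (𝓝[frontier C] c) (𝓝 0) := by
    have := he.continuousWithinAt.tendsto.sub_const c
    simpa only [hxc, sub_self] using this
  have heL : (fun z => e z - L (z - c)) =o[𝓝[frontier C] c] fun z => z - c := by
    have := he.isLittleO
    simpa only [hxc] using this
  have heO : e =O[𝓝[frontier C] c] fun z => z - c := by
    have := he.isBigO_sub
    simpa only [hxc] using this
  -- `L` takes tangential values, so `e` has no first-order normal component.
  have heν : (fun z => ⟪e z, ν⟫) =o[𝓝[frontier C] c] fun z => z - c := by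
    refine Asymptotics.IsBigO.trans_isLittleO (Asymptotics.IsBigO.of_bound 1
      (Eventually.of_forall fun z => ?_)) heL
    have h1 : ⟪e z, ν⟫ = ⟪e z - L (z - c), ν⟫ := by
      rw [inner_sub_left (e z), real_inner_comm ν (L _), hL, sub_zero]
    rw [h1, one_mul]
    refine (norm_inner_le_norm _ _).trans ?_
    rw [hn.1, mul_one]
  have hwν : ∀ᶠ z in 𝓝[frontier C] c, 1 / 2 < ⟪w z, ν⟫ := by
    have h1 : Tendsto (fun z => ⟪w z, ν⟫) (𝓝[frontier C] c) (𝓝 ⟪w c, ν⟫) :=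
      hw.tendsto.inner tendsto_const_nhds
    refine h1.eventually (lt_mem_nhds ?_)
    rw [hwc, real_inner_self_eq_norm_sq, hn.1]; norm_num
  have hw2 : ∀ᶠ z in 𝓝[frontier C] c, ‖w z‖ < 2 := by
    refine hw.tendsto.norm.eventually (gt_mem_nhds ?_)
    rw [hwc, hn.1]; norm_num
  have hqe : ∀ z, q z = x z - σ z • w z → q z - c = e z - (σ z - d) • w z := fun z hz => by
    rw [hz, hedef]; module
  have hneg : ⟪-ν, ν⟫ < 0 := by
    rw [inner_neg_left, real_inner_self_eq_norm_sq, hn.1]; norm_num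
  -- At time `d + t`, with small `t > 0`, the central half-line is at an interior point of `C`, so
  -- nearby half-lines are in `C` as well.
  have hupper : ∀ ε : ℝ, 0 < ε → ∀ᶠ z in 𝓝[frontier C] c,
      ∃ s : ℝ, 0 ≤ s ∧ s ≤ d + ε ∧ x z - s • w z ∈ C := by
    intro ε hε
    have h1 : ∀ᶠ t : ℝ in 𝓝[>] 0, t < ε := nhdsWithin_le_nhds (gt_mem_nhds hε)
    obtain ⟨t, ⟨ht, ht1⟩, ht0⟩ :=
      (((hn.interior.eventually_mem hneg).and h1).and self_mem_nhdsWithin).exists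
    have ht0' : 0 < t := ht0
    have h2 : Tendsto (fun z => x z - d • w z - t • w z) (𝓝[frontier C] c)
        (𝓝 (x c - d • w c - t • w c)) :=
      he.continuousWithinAt.tendsto.sub (hw.tendsto.const_smul t)
    rw [hxc, hwc, sub_eq_add_neg, ← smul_neg] at h2
    filter_upwards [h2.eventually (mem_interior_iff_mem_nhds.1 ht)] with z hz
    refine ⟨d + t, by positivity, by linarith, ?_⟩
    rwa [add_smul, ← sub_sub]
  have hq' : ∀ᶠ z in 𝓝[frontier C] c, q z ∈ frontier C ∧ q z = x z - σ z • w z := by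
    filter_upwards [hq, hupper 1 one_pos] with z hz hz'
    obtain ⟨s, h1, -, h3⟩ := hz'
    exact ⟨(hz ⟨s, h1, h3⟩).1, (hz ⟨s, h1, h3⟩).2.1⟩
  have hσ : Tendsto (fun z => σ z - d) (𝓝[frontier C] c) (𝓝 0) := by
    rw [Metric.tendsto_nhds]
    intro ε hε
    have h1 : ∀ᶠ z in 𝓝[frontier C] c, ‖e z‖ < ε / 2 := by
      have := het.norm
      rw [norm_zero] at this
      exact this.eventually (gt_mem_nhds (by positivity))
    filter_upwards [hq, hupper (ε / 2) (by positivity), h1, hwν] with z h2 h3 h4 h5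
    obtain ⟨s, hs1, hs2, hs3⟩ := h3
    obtain ⟨h6, h7, h8⟩ := h2 ⟨s, hs1, hs3⟩
    have h9 := hC.inner_sub_nonpos hc (hC.mem_of_frontier h6)
    rw [hqe z h7, inner_sub_left, inner_smul_left, conj_trivial] at h9
    have h10 := abs_le.1 (abs_real_inner_le_norm (e z) ν)
    rw [hn.1, mul_one] at h10
    rw [dist_zero_right, Real.norm_eq_abs, abs_lt]
    constructor
    -- Stopping much before time `d` would leave the point strictly beyond the supporting hyperplane
    -- at `c`.
    · by_contra! hlt
      nlinarith
    · have := h8 s hs1 hs3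
      linarith
  have hqt : Tendsto q (𝓝[frontier C] c) (𝓝[frontier C] c) := by
    refine tendsto_nhdsWithin_iff.2 ⟨?_, hq'.mono fun z hz => hz.1⟩
    have h1 : Tendsto (fun z => c + (e z - (σ z - d) • w z)) (𝓝[frontier C] c)
        (𝓝 (c + (0 - (0 : ℝ) • w c))) := tendsto_const_nhds.add (het.sub (hσ.smul hw.tendsto))
    rw [zero_smul, sub_zero, add_zero] at h1
    refine h1.congr' (hq'.mono fun z hz => ?_)
    rw [← hqe z hz.2]; abel
  -- Both `e z` and `q z - c` are nearly orthogonal to `ν`, and their difference is `(σ z - d) w z`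
  -- with `⟪w z, ν⟫ > 1/2`. The bound on `q z - c` itself contains `|σ z - d|`; with `η ≤ 1/8` that
  -- contribution is at most `|σ z - d| / 4` and is absorbed on the left.
  have hσo : (fun z => σ z - d) =o[𝓝[frontier C] c] fun z => z - c := by
    obtain ⟨K, hK, hKe⟩ := heO.exists_pos
    rw [Asymptotics.isLittleO_iff]
    intro ε hε
    set η := min (1 / 8) (ε / (8 * K)) with hη
    have hη0 : 0 < η := lt_min (by norm_num) (by positivity)
    have hη1 : η ≤ 1 / 8 := min_le_left _ _
    have hη2 : η * K ≤ ε / 8 := by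
      have := mul_le_mul_of_nonneg_right (min_le_right (1 / 8) (ε / (8 * K))) hK.le
      refine this.trans (le_of_eq ?_)
      field_simp
    filter_upwards [hq', hwν, hw2, hKe.bound, heν.def (show 0 < ε / 8 by positivity),
      (hn.isLittleO_inner.comp_tendsto hqt).def hη0] with z h1 h2 h3 h4 h5 h6
    simp only [Function.comp_apply] at h6
    have h7 : ‖q z - c‖ ≤ ‖e z‖ + |σ z - d| * 2 := by
      rw [hqe z h1.2]
      refine (norm_sub_le _ _).trans ?_
      rw [norm_smul, Real.norm_eq_abs]
      have := mul_le_mul_of_nonneg_left h3.le (abs_nonneg (σ z - d))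
      linarith
    have h8 : (σ z - d) * ⟪w z, ν⟫ = ⟪e z, ν⟫ - ⟪q z - c, ν⟫ := by
      rw [hqe z h1.2, inner_sub_left (e z), inner_smul_left, conj_trivial]; ring
    have h9 : |σ z - d| * ⟪w z, ν⟫ ≤ ‖⟪e z, ν⟫‖ + ‖⟪q z - c, ν⟫‖ := by
      rw [← abs_of_pos (show 0 < ⟪w z, ν⟫ by linarith), ← abs_mul, h8, ← Real.norm_eq_abs]
      exact norm_sub_le _ _
    rw [Real.norm_eq_abs (σ z - d)]
    have h10 : η * ‖q z - c‖ ≤ η * ‖e z‖ + η * (|σ z - d| * 2) := by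
      rw [← mul_add]; exact mul_le_mul_of_nonneg_left h7 hη0.le
    have h11 : η * ‖e z‖ ≤ ε / 8 * ‖z - c‖ := by
      calc η * ‖e z‖ ≤ η * (K * ‖z - c‖) := mul_le_mul_of_nonneg_left h4 hη0.le
        _ = η * K * ‖z - c‖ := by ring
        _ ≤ ε / 8 * ‖z - c‖ := mul_le_mul_of_nonneg_right hη2 (norm_nonneg _)
    have h12 : η * (|σ z - d| * 2) ≤ 1 / 8 * (|σ z - d| * 2) :=
      mul_le_mul_of_nonneg_right hη1 (by positivity)
    have h13 : |σ z - d| * (1 / 2) ≤ |σ z - d| * ⟪w z, ν⟫ :=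
      mul_le_mul_of_nonneg_left h2.le (abs_nonneg _)
    linarith
  have hqc : q c = c := by
    have h1 := (hσo.def one_pos).self_of_nhdsWithin hc
    rw [sub_self, norm_zero, mul_zero] at h1
    have h2 := hqe c (hq'.self_of_nhdsWithin hc).2
    rw [norm_le_zero_iff.1 h1, zero_smul, sub_zero, hedef] at h2
    simp only [hxc, sub_self] at h2
    exact sub_eq_zero.1 h2
  refine ⟨hqc, ?_⟩
  rw [hasFDerivWithinAt_iff_isLittleO, hqc]
  have h1 : (fun z => (σ z - d) • w z) =o[𝓝[frontier C] c] fun z => z - c := by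
    refine Asymptotics.IsBigO.trans_isLittleO (Asymptotics.IsBigO.of_bound 2 ?_) hσo
    filter_upwards [hw2] with z hz
    rw [norm_smul, mul_comm]
    exact mul_le_mul_of_nonneg_right hz.le (norm_nonneg _)
  refine (heL.sub h1).congr' ?_ EventuallyEq.rfl
  filter_upwards [hq'] with z hz
  rw [hqe z hz.2]
  abel

/-! ### The linearization of the return map -/

/-- A product rule for an operator field that is only continuous: since `g` vanishes at `c`, the
variation of `B` contributes `o(1) · O(z - c)`. -/
theorem hasFDerivWithinAt_clm_apply_of_eq_zero {s : Set E} {B : E → E →L[ℝ] E} {g : E → E}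
    {g' : E →L[ℝ] E} (hB : ContinuousWithinAt B s c) (hg : HasFDerivWithinAt g g' s c)
    (h0 : g c = 0) : HasFDerivWithinAt (fun z => B z (g z)) (B c ∘L g') s c := by
  rw [hasFDerivWithinAt_iff_isLittleO]
  have h1 : (fun z => (B z - B c) (g z)) =o[𝓝[s] c] fun z => z - c := by
    have h2 : (fun z => B z - B c) =o[𝓝[s] c] fun _ => (1 : ℝ) := by
      rw [Asymptotics.isLittleO_one_iff]
      have := hB.tendsto.sub_const (B c)
      rwa [sub_self] at this
    have h3 : g =O[𝓝[s] c] fun z => z - c := by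
      have := hg.isBigO_sub
      simpa only [h0, sub_zero] using this
    have h4 := h2.norm_left.mul_isBigO h3.norm_norm
    simp only [one_mul] at h4
    refine Asymptotics.IsBigO.trans_isLittleO (Asymptotics.IsBigO.of_bound 1
      (Eventually.of_forall fun z => ?_)) h4.of_norm_right
    rw [one_mul, norm_mul, norm_norm, norm_norm]
    exact (B z - B c).le_opNorm _
  have h5 := ((B c).isBigO_comp _ _).trans_isLittleO hg.isLittleO
  refine (h1.add h5).congr_left fun z => ?_
  simp only [h0, sub_zero, sub_apply, map_sub, map_zero, ContinuousLinearMap.comp_apply]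
  abel

theorem IsConvexCore.continuousWithinAt_parallelInverse (hC : IsConvexCore C)
    (hc : c ∈ frontier C) {d : E → ℝ} (hd : ContinuousWithinAt d (frontier C) c)
    (hpos : 0 ≤ d c) :
    ContinuousWithinAt (fun z => parallelInverse C z (d z)) (frontier C) c := by
  have h1 : ContinuousWithinAt
      (fun z => ContinuousLinearMap.id ℝ E - d z • shapeOperator C z) (frontier C) c :=
    continuousWithinAt_const.sub (hd.smul (hC.continuousWithinAt_shapeOperator hc))
  have h2 : ContinuousAt (ContinuousLinearMap.inverse : (E →L[ℝ] E) → (E →L[ℝ] E))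
      (ContinuousLinearMap.id ℝ E - d c • shapeOperator C c) :=
    ((hC.isInvertible hc hpos).contDiffAt_map_inverse (n := 0)).continuousAt
  exact ContinuousAt.comp_continuousWithinAt
    (f := fun z => ContinuousLinearMap.id ℝ E - d z • shapeOperator C z) h2 h1

theorem IsCriticalConfiguration.thicknessHess_eq (h : IsCriticalConfiguration C Ω c) :
    thicknessHess C Ω c = surfaceDeriv C (surfaceGrad C (thickness C Ω)) c :=
  h.core.surfaceHess_eq h.critical.1 h.thickness_C2 h.critical.2.1

/-- The formula `DF = I + ½ A Hess d`, from the first-hit lemma applied to the half-lines `Φ(z) - s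
w(z)`, with the unnormalized normal `w` as velocity. -/
theorem IsCriticalConfiguration.returnMap_spec (h : IsCriticalConfiguration C Ω c) :
    returnMap C Ω c = c ∧ HasSurfaceDerivAt C (returnMap C Ω)
      (tangentProj C c + (1 / 2 : ℝ) • (geometricOperator C Ω c ∘L thicknessHess C Ω c)) c := by
  have hC := h.core
  have hc := h.critical.1
  have hΩ := h.admissible
  have hn := hC.isOutwardUnitNormal hc
  have hg0 : surfaceGrad C (thickness C Ω) c = 0 := h.critical.2.1
  have hdiff : ∀ z ∈ frontier C, DifferentiableWithinAt ℝ (thickness C Ω) (frontier C) z :=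
    fun z hz => (h.thickness_C2 z hz).differentiableWithinAt (by norm_num)
  have hpos : ∀ z ∈ frontier C, 0 < thickness C Ω z := fun z hz => hΩ.thickness_pos hC hz
  set d := thickness C Ω with hd
  set H := surfaceDeriv C (surfaceGrad C d) c with hH
  set M := parallelInverse C c (d c) with hM
  have hgd : HasSurfaceDerivAt C (surfaceGrad C d) H c := hasSurfaceDerivAt_surfaceDeriv hn
    (hC.differentiableWithinAt_surfaceGrad hc (h.thickness_C2 c hc))
  have hHess : thicknessHess C Ω c = H := h.thicknessHess_eq
  have hprH : ∀ v, tangentProj C c (H v) = H v := fun v => by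
    have h1 := hC.surfaceHess_eq hc h.thickness_C2 h.critical.2.1
    have h2 := congrArg (fun L : E →L[ℝ] E => L v) h1
    exact h2
  have hνd := (hC.hasSurfaceDerivAt_outwardNormal hc).1
  have hw : HasFDerivWithinAt (radialCovector C d) (-shapeOperator C c - M ∘L H) (frontier C) c :=
    hνd.sub (hasFDerivWithinAt_clm_apply_of_eq_zero (hC.continuousWithinAt_parallelInverse hc
      (hdiff c hc).continuousWithinAt (hpos c hc).le) hgd.1 hg0)
  have hwc : radialCovector C d c = outwardNormal C c := by
    rw [radialCovector, hg0, map_zero, sub_zero]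
  have hx : HasFDerivWithinAt (radialMap C Ω) (tangentProj C c - d c • shapeOperator C c)
      (frontier C) c := by
    have h1 : HasFDerivWithinAt d (0 : E →L[ℝ] ℝ) (frontier C) c := by
      have h2 := (hasSurfaceDerivAt_surfaceDeriv hn (hdiff c hc)).1
      have h3 : surfaceDeriv C d c = 0 := by
        ext1 v
        rw [← inner_surfaceGrad, hg0, inner_zero_left, zero_apply]
      rwa [h3] at h2
    have h4 := (hasSurfaceDerivAt_comp_tangentProj hn
      (hasFDerivWithinAt_id (𝕜 := ℝ) c (frontier C))).1
    refine (h4.add (h1.smul hνd)).congr_fderiv ?_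
    ext1 v
    simp [sub_eq_add_neg]
  -- The term `-dS` from the radial map cancels the term `+dS` from the turning normal.
  have he : HasFDerivWithinAt (fun z => radialMap C Ω z - d c • radialCovector C d z)
      (tangentProj C c + d c • (M ∘L H)) (frontier C) c := by
    refine (hx.sub (hw.const_smul (d c))).congr_fderiv ?_
    rw [smul_sub, smul_neg]
    abel
  -- The return time is measured along the unit normal; dividing it by `‖w‖` gives the parameter
  -- along `w`.
  have hfin := hC.hasFDerivWithinAt_firstHit hc (x := radialMap C Ω) (w := radialCovector C d)
    (q := returnMap C Ω) (σ := fun z => returnTime C Ω (radialMap C Ω z) *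
      ‖radialCovector C d z‖⁻¹) (hpos c hc).le he ?_ hw.continuousWithinAt hwc ?_ ?_
  · refine ⟨hfin.1, ?_⟩
    have hL : tangentProj C c + (1 / 2 : ℝ) • (geometricOperator C Ω c ∘L thicknessHess C Ω c) =
        tangentProj C c + d c • (M ∘L H) := by
      ext1 v
      have : geometricOperator C Ω c (H v) = (2 * d c) • M (H v) := by
        rw [geometricOperator, smul_apply, ContinuousLinearMap.comp_apply, hprH]
        rfl
      simp only [add_apply, smul_apply, ContinuousLinearMap.comp_apply, hHess, this, smul_smul]
      congr 2
      ring
    rw [hL]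
    refine ⟨hfin.2, ?_⟩
    rw [add_apply, smul_apply, ContinuousLinearMap.comp_apply, hgd.2, tangentProj_normal hn]
    simp
  · rw [hwc, radialMap, add_sub_cancel_right]
  · intro v
    rw [add_apply, smul_apply, ContinuousLinearMap.comp_apply, inner_add_right,
      inner_tangentProj hn, inner_smul_right,
      hC.inner_outwardNormal_parallelInverse hc (hpos c hc).le, ← hprH, inner_tangentProj hn]
    simp
  · filter_upwards [self_mem_nhdsWithin] with z hz hex
    obtain ⟨s, hs, hsC⟩ := hex
    have hw0 := norm_pos_iff.2 (hC.radialCovector_ne_zero hz (hdiff z hz) (hpos z hz))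
    have hin : inwardNormal Ω (radialMap C Ω z) =
        -(‖radialCovector C d z‖⁻¹ • radialCovector C d z) := by
      rw [inwardNormal, neg_inj]
      exact (hC.isOutwardUnitNormal_radial hz (hdiff z hz) (hpos z hz)
        fun y hy => hΩ.mem_iff hC hy).outwardNormal_eq
    have hxC : radialMap C Ω z ∉ C := hC.ray_notMem hz (hpos z hz)
    have hmem : ∀ s : ℝ, radialMap C Ω z - s • radialCovector C d z ∈ C →
        radialMap C Ω z + (s * ‖radialCovector C d z‖) • inwardNormal Ω (radialMap C Ω z) ∈ C := by
      intro s hs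
      convert hs using 1
      rw [hin, smul_neg, smul_smul, mul_assoc, mul_inv_cancel₀ hw0.ne', mul_one, sub_eq_add_neg]
    obtain ⟨h1, h2⟩ := firstHit_spec hC.isCompact.isClosed hxC ⟨_, by positivity, hmem s hsC⟩
    refine ⟨h1, ?_, fun s hs hsC => ?_⟩
    · rw [returnMap, reciprocalMap, hin, smul_neg, smul_smul, sub_eq_add_neg]
    · have := h2 _ (by positivity) (hmem s hsC)
      rw [← div_eq_mul_inv, div_le_iff₀ hw0]
      exact this

theorem IsCriticalConfiguration.linearization_eq (h : IsCriticalConfiguration C Ω c) :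
    linearization C Ω c = tangentProj C c +
      (1 / 2 : ℝ) • (geometricOperator C Ω c ∘L thicknessHess C Ω c) :=
  h.returnMap_spec.2.surfaceDeriv_eq (h.core.isOutwardUnitNormal h.critical.1)

theorem tangentProj_congr {C' : Set E} (h : outwardNormal C c = outwardNormal C' c) :
    tangentProj C c = tangentProj C' c := by
  have : tangentSpace C c = tangentSpace C' c := by rw [tangentSpace, tangentSpace, h]
  simp only [tangentProj, this]

theorem IsCriticalConfiguration.linearization_eq_iff {C' Ω' : Set E}
    (h : IsCriticalConfiguration C Ω c) (h' : IsCriticalConfiguration C' Ω' c)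
    (hν : outwardNormal C c = outwardNormal C' c) :
    linearization C Ω c = linearization C' Ω' c ↔
      geometricOperator C Ω c ∘L thicknessHess C Ω c =
        geometricOperator C' Ω' c ∘L thicknessHess C' Ω' c := by
  rw [h.linearization_eq, h'.linearization_eq, tangentProj_congr hν, add_right_inj]
  exact (smul_right_injective (E →L[ℝ] E) (show (1 / 2 : ℝ) ≠ 0 by norm_num)).eq_iff

/-! ### Lipschitz boundaries -/

/-- An open set with a uniform cone condition near a boundary point is the subgraph of a Lipschitz
function there. -/
theorem isLipschitzBoundaryAt_of_cone (hΩ : IsOpen Ω) {x e : E} (he : ‖e‖ = 1)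
    (hx : x ∈ closure Ω) (K : NNReal) {δ : ℝ} (hδ : 0 < δ)
    (hcone : ∀ y ∈ Metric.ball x δ, ∀ y' ∈ Metric.ball x δ, y' ∈ Ω →
      K * ‖(y - ⟪e, y⟫ • e) - (y' - ⟪e, y'⟫ • e)‖ < ⟪e, y'⟫ - ⟪e, y⟫ → y ∈ Ω) :
    IsLipschitzBoundaryAt Ω x := by
  have hee : ⟪e, e⟫ = 1 := by rw [real_inner_self_eq_norm_sq, he, one_pow]
  set B := Ω ∩ Metric.ball x δ with hB
  have hBne : B.Nonempty := by
    rw [hB, inter_comm]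
    exact mem_closure_iff.1 hx _ Metric.isOpen_ball (Metric.mem_ball_self hδ)
  have hBopen : IsOpen B := hΩ.inter Metric.isOpen_ball
  have : Nonempty B := hBne.to_subtype
  -- The upper envelope of the downward cones of slope `K` with apex at points of `Ω` near `x`.
  set g : E → ℝ := fun z => ⨆ y : B, (⟪e, (y : E)⟫ - K * ‖z - ((y : E) - ⟪e, (y : E)⟫ • e)‖)
    with hg
  have hbdd : ∀ z, BddAbove (range fun y : B =>
      ⟪e, (y : E)⟫ - K * ‖z - ((y : E) - ⟪e, (y : E)⟫ • e)‖) := by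
    intro z
    refine ⟨⟪e, x⟫ + δ, ?_⟩
    rintro _ ⟨⟨y, hy⟩, rfl⟩
    have h1 := real_inner_le_norm e (y - x)
    rw [he, one_mul, inner_sub_right] at h1
    have h2 : ‖y - x‖ < δ := by rw [← dist_eq_norm]; exact hy.2
    have h3 : 0 ≤ (K : ℝ) * ‖z - (y - ⟪e, y⟫ • e)‖ := by positivity
    change ⟪e, y⟫ - _ ≤ _
    linarith
  refine ⟨e, K, g, he, LipschitzWith.of_le_add_mul K fun z z' => ?_, ?_⟩
  · refine ciSup_le fun y => ?_
    have h1 := le_ciSup (hbdd z') y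
    have h2 : ‖z' - ((y : E) - ⟪e, (y : E)⟫ • e)‖ ≤
        ‖z - ((y : E) - ⟪e, (y : E)⟫ • e)‖ + dist z z' := by
      rw [dist_comm, dist_eq_norm, add_comm]
      exact norm_sub_le_norm_sub_add_norm_sub _ _ _
    have h3 := mul_le_mul_of_nonneg_left h2 K.coe_nonneg
    linarith
  · filter_upwards [Metric.ball_mem_nhds x hδ] with y hy
    constructor
    · intro hyΩ
      -- A slightly higher point still belongs to the open set, which makes the inequality strict.
      have h1 := eventually_ray (u := e) (hBopen.mem_nhds ⟨hyΩ, hy⟩)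
      obtain ⟨s, hs, hs0⟩ := (h1.and self_mem_nhdsWithin).exists
      have hs0' : 0 < s := hs0
      have h2 : ⟪e, y + s • e⟫ - K * ‖y - ⟪e, y⟫ • e - (y + s • e - ⟪e, y + s • e⟫ • e)‖ ≤
        g (y - ⟪e, y⟫ • e) := le_ciSup (hbdd (y - ⟪e, y⟫ • e)) ⟨y + s • e, hs⟩
      have h3 : y - ⟪e, y⟫ • e - (y + s • e - ⟪e, y + s • e⟫ • e) = 0 := by
        rw [inner_add_right, inner_smul_right, hee]
        module
      rw [h3, norm_zero, mul_zero, sub_zero, inner_add_right, inner_smul_right, hee] at h2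
      refine lt_of_lt_of_le ?_ h2
      linarith
    · intro hlt
      obtain ⟨⟨y', hy'⟩, h1⟩ := exists_lt_of_lt_ciSup hlt
      refine hcone y hy y' hy'.2 hy'.1 ?_
      simp only at h1
      linarith

/-! ### Tubular domains -/

/-- The domain around `C` of thickness `D`. -/
def tube (C : Set E) (D : E → ℝ) : Set E := {y | height C y < D (nearestPoint C y)}

theorem IsConvexCore.isOpen_tube (hC : IsConvexCore C) {D : E → ℝ} (hD : Continuous D) :
    IsOpen (tube C D) :=
  isOpen_lt hC.continuous_height (hD.comp hC.continuous_nearestPoint)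

theorem IsConvexCore.subset_tube (hC : IsConvexCore C) {D : E → ℝ} (hpos : ∀ x, 0 < D x) :
    C ⊆ tube C D := fun y hy => by
  change height C y < _
  rw [hC.height_of_mem hy]
  exact hpos _

theorem IsConvexCore.ray_mem_tube_iff (hC : IsConvexCore C) (hc : c ∈ frontier C) {D : E → ℝ}
    {t : ℝ} (ht : 0 ≤ t) : c + t • outwardNormal C c ∈ tube C D ↔ t < D c := by
  change height C _ < _ ↔ _
  rw [hC.height_ray hc ht, hC.nearestPoint_ray hc ht]

theorem IsConvexCore.radii_tube (hC : IsConvexCore C) (hc : c ∈ frontier C) (D : E → ℝ) :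
    {r : ℝ | 0 ≤ r ∧ c + r • outwardNormal C c ∈ tube C D} = Ico 0 (D c) := by
  ext r
  exact and_congr_right fun hr => hC.ray_mem_tube_iff hc hr

theorem IsConvexCore.thickness_tube (hC : IsConvexCore C) (hc : c ∈ frontier C) {D : E → ℝ}
    (hpos : ∀ x, 0 < D x) : thickness C (tube C D) c = D c := by
  rw [thickness, hC.radii_tube hc, csSup_Ico (hpos c)]

/-- Along the normal `e` the distance grows at a rate close to one, while `D ∘ P` has Lipschitz
constant `1/2`. With cone slope `8`, a descent by `a` has length at most `9a/8`; the deviation of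
the normal and the variation of `D ∘ P` cost at most `(1/8 + 1/2) · 9a/8 < a`. -/
theorem IsConvexCore.isLipschitzBoundaryAt_tube (hC : IsConvexCore C) {D : E → ℝ}
    (hD : LipschitzWith (1 / 2) D) {x : E} (hx : x ∈ closure (tube C D)) (hxC : x ∉ C) :
    IsLipschitzBoundaryAt (tube C D) x := by
  set e := outwardNormal C (nearestPoint C x) with he
  have he1 : ‖e‖ = 1 := hC.norm_outwardNormal (hC.nearestPoint_mem_frontier hxC)
  have h1 := Metric.tendsto_nhds.1 (hC.continuousAt_outwardNormal_nearestPoint hxC)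
    (1 / 8) (by norm_num)
  obtain ⟨δ, hδ, hball⟩ := Metric.eventually_nhds_iff_ball.1
    (h1.and (hC.isCompact.isClosed.isOpen_compl.mem_nhds hxC))
  refine isLipschitzBoundaryAt_of_cone (hC.isOpen_tube hD.continuous) he1 hx 8 hδ ?_
  intro y hy y' hy' hy'Ω hlt
  obtain ⟨h2, hyC⟩ := hball y hy
  set a := ⟪e, y'⟫ - ⟪e, y⟫ with ha
  set b := (y - ⟪e, y⟫ • e) - (y' - ⟪e, y'⟫ • e) with hb
  have hab : y' - y = a • e - b := by rw [ha, hb]; module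
  have hb8 : 8 * ‖b‖ < a := by simpa using hlt
  have ha0 : 0 < a := lt_of_le_of_lt (by positivity) hb8
  have hu : ‖y' - y‖ ≤ a + ‖b‖ := by
    rw [hab]
    refine (norm_sub_le _ _).trans ?_
    rw [norm_smul, he1, mul_one, Real.norm_of_nonneg ha0.le]
  have h3 := hC.height_add_inner_le hyC y'
  have h4 : a - 1 / 8 * ‖y' - y‖ ≤ ⟪outwardNormal C (nearestPoint C y), y' - y⟫ := by
    have h5 := abs_le.1 (abs_real_inner_le_norm
      (outwardNormal C (nearestPoint C y) - e) (y' - y))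
    rw [dist_eq_norm] at h2
    have h6 := mul_le_mul_of_nonneg_right h2.le (norm_nonneg (y' - y))
    have h7 : ⟪e, y' - y⟫ = a := by rw [inner_sub_right]
    rw [inner_sub_left, h7] at h5
    linarith [h5.1]
  have h8 : D (nearestPoint C y') ≤ D (nearestPoint C y) + 1 / 2 * ‖y' - y‖ := by
    have h9 := hD.le_add_mul (nearestPoint C y') (nearestPoint C y)
    have h10 := hC.norm_nearestPoint_sub_le y' y
    rw [dist_eq_norm] at h9
    have h11 : (((1 / 2 : NNReal)) : ℝ) = 1 / 2 := by simp
    rw [h11] at h9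
    linarith
  have h12 : height C y' < D (nearestPoint C y') := hy'Ω
  change height C y < D (nearestPoint C y)
  linarith

theorem IsConvexCore.isAdmissible_tube (hC : IsConvexCore C) {D : E → ℝ}
    (hD : LipschitzWith (1 / 2) D) (hdiff : Differentiable ℝ D) (hpos : ∀ x, 0 < D x)
    (hhit : ∀ c ∈ frontier C, ∃ t : ℝ, 0 ≤ t ∧
      c + D c • outwardNormal C c - t • radialCovector C D c ∈ C) :
    IsAdmissible C (tube C D) := by
  have hopen := hC.isOpen_tube hD.continuous
  have hsub := hC.subset_tube hpos
  refine ⟨hopen, interior_subset.trans hsub, fun x hx =>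
    hC.isLipschitzBoundaryAt_tube hD hx.1.1 hx.2, fun c hc => ?_, ⟨hopen, hsub, ?_⟩, fun c hc => ?_⟩
  · have h1 : normalRay C c ∩ tube C D =
        (fun t : ℝ => c + t • outwardNormal C c) '' Ico 0 (D c) := by
      rw [← hC.radii_tube hc]
      ext y
      constructor
      · rintro ⟨⟨t, ht, rfl⟩, h2⟩
        exact ⟨t, ⟨ht, h2⟩, rfl⟩
      · rintro ⟨t, ⟨ht, h2⟩, rfl⟩
        exact ⟨⟨t, ht, rfl⟩, h2⟩
    rw [h1]
    exact (isConnected_Ico (hpos c)).image _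
      (by fun_prop : Continuous fun t : ℝ => c + t • outwardNormal C c).continuousOn
  · refine Eventually.of_forall fun x hx n hn => ?_
    have hxΩ : x ∉ tube C D := fun h => hx.2 (by rwa [hopen.interior_eq])
    have hxC : x ∉ C := fun h => hxΩ (hsub h)
    have hle : height C x ≤ D (nearestPoint C x) :=
      closure_lt_subset_le hC.continuous_height (hD.continuous.comp hC.continuous_nearestPoint)
        hx.1
    -- So every frontier point of the tube is the radial image of its foot point, where the normal
    -- is known.
    have heq : height C x = D (nearestPoint C x) := le_antisymm hle (not_lt.1 hxΩ)
    have hc := hC.nearestPoint_mem_frontier hxC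
    have hxr := hC.eq_ray hxC
    rw [heq] at hxr
    set c := nearestPoint C x with hcdef
    have hw := hC.isOutwardUnitNormal_radial (Ω := tube C D) hc
      (hdiff c).differentiableWithinAt (hpos c) (fun y _ => Iff.rfl)
    rw [← hxr] at hw
    have hnw := hn.unique hw
    have hw0 := norm_pos_iff.2
      (hC.radialCovector_ne_zero hc (hdiff c).differentiableWithinAt (hpos c))
    obtain ⟨t, ht, htC⟩ := hhit c hc
    rw [← hxr] at htC
    refine ⟨t * ‖radialCovector C D c‖, by positivity, ?_⟩
    rw [← neg_neg n, hnw, smul_neg, smul_smul, mul_assoc, mul_inv_cancel₀ hw0.ne', mul_one,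
      ← sub_eq_add_neg]
    exact htC
  · rw [hC.radii_tube hc]
    exact bddAbove_Ico

/-! ### Symmetry of the Hessian at a critical point -/

theorem IsConvexCore.continuousAt_parallelInverse_nearestPoint (hC : IsConvexCore C) {x : E}
    (hx : x ∉ C) :
    ContinuousAt (fun y => parallelInverse C (nearestPoint C y) (height C y)) x := by
  have hc := hC.nearestPoint_mem_frontier hx
  have h0 : ContinuousAt (fun y => shapeOperator C (nearestPoint C y)) x :=
    (hC.continuousWithinAt_shapeOperator hc).tendsto.comp (hC.tendsto_nearestPoint hx)
  have h1 : ContinuousAt (fun y => ContinuousLinearMap.id ℝ E -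
      height C y • shapeOperator C (nearestPoint C y)) x :=
    continuousAt_const.sub (hC.continuous_height.continuousAt.smul h0)
  have h2 : ContinuousAt (ContinuousLinearMap.inverse : (E →L[ℝ] E) → (E →L[ℝ] E))
      (ContinuousLinearMap.id ℝ E - height C x • shapeOperator C (nearestPoint C x)) :=
    ((hC.isInvertible hc (hC.height_pos hx).le).contDiffAt_map_inverse (n := 0)).continuousAt
  exact ContinuousAt.comp (f := fun y => ContinuousLinearMap.id ℝ E -
      height C y • shapeOperator C (nearestPoint C y)) h2 h1

/-- Near a point at distance one from `C`, `f ∘ P` is an ordinary function with gradient `M grad f`.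
Because `grad f` vanishes at `c`, this gradient is differentiable there, with derivative `M H M` on
tangent vectors. Symmetry of second derivatives passes to `H`, as `M` is self-adjoint and
invertible. -/
theorem IsConvexCore.inner_surfaceHess (hC : IsConvexCore C)
    (hc : c ∈ frontier C) {f : E → ℝ} (hf : ContDiffOn ℝ 2 f (frontier C))
    (hcrit : surfaceGrad C f c = 0) (v w : E) :
    ⟪surfaceHess C f c v, w⟫ = ⟪v, surfaceHess C f c w⟫ := by
  have hn := hC.isOutwardUnitNormal hc
  have hg := hasSurfaceDerivAt_surfaceDeriv hn
    (hC.differentiableWithinAt_surfaceGrad hc (hf c hc))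
  have hprH : ∀ v, tangentProj C c (surfaceHess C f c v) = surfaceHess C f c v := fun v => by
    conv_rhs => rw [hC.surfaceHess_eq hc hf hcrit]
    rw [hC.surfaceHess_eq hc hf hcrit]
    exact congrArg (fun L : E →L[ℝ] E => L v) (hC.surfaceHess_eq hc hf hcrit)
  rw [← hC.surfaceHess_eq hc hf hcrit] at hg
  set H := surfaceHess C f c with hH
  set x := c + (1 : ℝ) • outwardNormal C c with hxdef
  have hx : x ∉ C := hC.ray_notMem hc one_pos
  have hPx : nearestPoint C x = c := hC.nearestPoint_ray hc zero_le_one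
  have hhx : height C x = 1 := hC.height_ray hc zero_le_one
  set M := parallelInverse C c 1 with hM
  have hgP : HasFDerivAt (fun y => surfaceGrad C f (nearestPoint C y))
      (H ∘L (M ∘L tangentProj C c)) x := by
    have hPd := hC.hasFDerivAt_nearestPoint hx
    rw [hPx, hhx] at hPd
    have h1 := hg.1
    rw [← hPx] at h1
    rw [hasFDerivAt_iff_isLittleO]
    have h0 : (fun y => nearestPoint C y - nearestPoint C x) =O[𝓝 x] fun y => y - x :=
      Asymptotics.IsBigO.of_bound 1 (Eventually.of_forall fun z => by
        rw [one_mul]; exact hC.norm_nearestPoint_sub_le z x)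
    have h2 := (h1.isLittleO.comp_tendsto (hC.tendsto_nearestPoint hx)).trans_isBigO h0
    have h3 := (H.isBigO_comp _ _).trans_isLittleO hPd.isLittleO
    refine (h2.add h3).congr_left fun y => ?_
    simp only [Function.comp_apply, ContinuousLinearMap.comp_apply, map_sub]
    abel
  have hMg : HasFDerivAt (fun y => parallelInverse C (nearestPoint C y) (height C y)
      (surfaceGrad C f (nearestPoint C y))) (M ∘L (H ∘L (M ∘L tangentProj C c))) x := by
    have := hasFDerivWithinAt_clm_apply_of_eq_zero
      (hC.continuousAt_parallelInverse_nearestPoint hx).continuousWithinAt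
      (hgP.hasFDerivWithinAt (s := univ)) (by rw [hPx, hcrit])
    rw [hasFDerivWithinAt_univ, hPx, hhx] at this
    exact this
  have hev : ∀ᶠ y in 𝓝 x, HasFDerivAt (fun y => f (nearestPoint C y))
      (innerSL ℝ (parallelInverse C (nearestPoint C y) (height C y)
        (surfaceGrad C f (nearestPoint C y)))) y := by
    filter_upwards [hC.isCompact.isClosed.isOpen_compl.mem_nhds hx] with y hy
    exact hC.hasFDerivAt_comp_nearestPoint hy
      ((hf _ (hC.nearestPoint_mem_frontier hy)).differentiableWithinAt (by norm_num))
  have hsymm : ∀ v w, ⟪M (H (M (tangentProj C c v))), w⟫ =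
      ⟪M (H (M (tangentProj C c w))), v⟫ := fun v w =>
    second_derivative_symmetric_of_eventually hev ((innerSL ℝ).hasFDerivAt.comp x hMg) v w
  have htan : ∀ v w, ⟪outwardNormal C c, v⟫ = 0 → ⟪outwardNormal C c, w⟫ = 0 →
      ⟪H v, w⟫ = ⟪H w, v⟫ := by
    intro v w hv hw
    have h1 : ∀ u, ⟪outwardNormal C c, u⟫ = 0 →
        M (tangentProj C c (u - (1 : ℝ) • shapeOperator C c u)) = u := fun u hu => by
      rw [tangentProj_of_inner_eq_zero hn, hC.parallelInverse_apply_sub hc zero_le_one]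
      rw [inner_sub_right, inner_smul_right, hC.inner_outwardNormal_shapeOperator hc, hu]
      simp
    have h2 : ∀ u, M (u - (1 : ℝ) • shapeOperator C c u) = u := fun u =>
      hC.parallelInverse_apply_sub hc zero_le_one u
    -- Testing on `(I - S)v` and `(I - S)w` cancels both factors `M`.
    have h3 := hsymm (v - (1 : ℝ) • shapeOperator C c v) (w - (1 : ℝ) • shapeOperator C c w)
    rw [h1 v hv, h1 w hw, hC.inner_parallelInverse hc zero_le_one,
      hC.inner_parallelInverse hc zero_le_one, h2, h2] at h3
    exact h3
  have hHpr : ∀ v, H (tangentProj C c v) = H v := fun v => by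
    rw [tangentProj_apply hn, map_sub, map_smul, hg.2, smul_zero, sub_zero]
  have hνH : ∀ v, ⟪outwardNormal C c, H v⟫ = 0 := fun v => by
    rw [← hprH, inner_tangentProj hn]
  rw [← inner_tangentProj_right hn w (hνH v), ← hHpr v,
    htan _ _ (inner_tangentProj hn v) (inner_tangentProj hn w), hHpr w,
    inner_tangentProj_right hn v (hνH w), real_inner_comm]

/-! ### Domains with prescribed thickness and Hessian -/

/-- A positive function, nearly constant, and constant off a small ball, with prescribed value and
Hessian at a critical point. -/
theorem exists_bump (c : E) (G : E →L[ℝ] E) (hG : ∀ v w, ⟪G v, w⟫ = ⟪v, G w⟫) {d₀ ε r : ℝ}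
    (hd₀ : 0 < d₀) (hε : 0 < ε) (hr : 0 < r) :
    ∃ D : E → ℝ, ContDiff ℝ 2 D ∧ (∀ x, ‖fderiv ℝ D x‖ ≤ ε) ∧ (∀ x, 0 < D x) ∧
      (∀ x, D x < 2 * d₀) ∧ D c = d₀ ∧ (∀ x, r ≤ ‖x - c‖ → fderiv ℝ D x = 0) ∧
      ∀ᶠ x in 𝓝 c, HasFDerivAt D (innerSL ℝ (G (x - c))) x := by
  let χ : ContDiffBump (0 : E) := ⟨1, 2, by norm_num, by norm_num⟩
  set φ : E → ℝ := fun u => χ u * (1 / 2 * ⟪G u, u⟫) with hφ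
  have hφC : ContDiff ℝ 2 φ := by
    have h1 : ContDiff ℝ 2 χ := χ.contDiff
    have h2 : ContDiff ℝ 2 fun u : E => ⟪G u, u⟫ := G.contDiff.inner ℝ contDiff_id
    exact h1.mul (contDiff_const.mul h2)
  have hφsupp : HasCompactSupport φ := χ.hasCompactSupport.mul_right
  obtain ⟨B₁, hB₁⟩ := hφC.continuous.bounded_above_of_compact_support hφsupp
  obtain ⟨B₂, hB₂⟩ := (hφC.continuous_fderiv (by norm_num)).bounded_above_of_compact_support
    (hφsupp.fderiv ℝ)
  have hφ0 : φ 0 = 0 := by simp [hφ]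
  have hφd0 : ∀ u, 2 < ‖u‖ → fderiv ℝ φ u = 0 := by
    intro u hu
    by_contra hne
    have h1 : u ∈ tsupport φ := support_fderiv_subset ℝ hne
    have h2 : u ∈ tsupport χ := tsupport_mul_subset_left h1
    rw [χ.tsupport_eq, mem_closedBall_zero_iff] at h2
    exact absurd h2 (not_le.2 hu)
  have hB₁0 : 0 ≤ B₁ := (norm_nonneg _).trans (hB₁ 0)
  have hB₂0 : 0 ≤ B₂ := (norm_nonneg _).trans (hB₂ 0)
  -- The bump `s² φ((x - c)/s)` has size `s²`, gradient of order `s` and a Hessian independent of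
  -- `s`. It lives in the ball of radius `2s`, hence `s < r / 2`.
  obtain ⟨s, hs, hs1, hsε, hsd, hsr⟩ : ∃ s : ℝ, 0 < s ∧ s < 1 ∧ s * B₂ ≤ ε ∧ s * B₁ < d₀ ∧
      s < r / 2 := by
    have e1 : ∀ᶠ s : ℝ in 𝓝[>] 0, s * B₂ < ε := by
      have : Tendsto (fun s : ℝ => s * B₂) (𝓝[>] 0) (𝓝 (0 * B₂)) :=
        ((continuous_id.mul continuous_const).tendsto 0).mono_left nhdsWithin_le_nhds
      exact this.eventually (gt_mem_nhds (by simpa using hε))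
    have e2 : ∀ᶠ s : ℝ in 𝓝[>] 0, s * B₁ < d₀ := by
      have : Tendsto (fun s : ℝ => s * B₁) (𝓝[>] 0) (𝓝 (0 * B₁)) :=
        ((continuous_id.mul continuous_const).tendsto 0).mono_left nhdsWithin_le_nhds
      exact this.eventually (gt_mem_nhds (by simpa using hd₀))
    have e3 : ∀ᶠ s : ℝ in 𝓝[>] 0, s < 1 := nhdsWithin_le_nhds (gt_mem_nhds one_pos)
    have e4 : ∀ᶠ s : ℝ in 𝓝[>] 0, s < r / 2 := nhdsWithin_le_nhds (gt_mem_nhds (by positivity))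
    obtain ⟨s, h1, h2, h3, h4, h5⟩ :=
      (e1.and (e2.and (e3.and (e4.and self_mem_nhdsWithin)))).exists
    exact ⟨s, h5, h3, h1.le, h2, h4⟩
  set D : E → ℝ := fun x => d₀ + s ^ 2 * φ (s⁻¹ • (x - c)) with hD
  have hDd : ∀ x, HasFDerivAt D (s • fderiv ℝ φ (s⁻¹ • (x - c))) x := by
    intro x
    have h1 : HasFDerivAt (fun x : E => s⁻¹ • (x - c)) (s⁻¹ • ContinuousLinearMap.id ℝ E) x :=
      ((hasFDerivAt_id x).sub_const c).const_smul s⁻¹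
    have h2 : HasFDerivAt φ (fderiv ℝ φ (s⁻¹ • (x - c))) (s⁻¹ • (x - c)) :=
      (hφC.differentiable (by norm_num) _).hasFDerivAt
    refine (((h2.comp x h1).const_mul (s ^ 2)).const_add d₀).congr_fderiv ?_
    ext1 v
    simp only [smul_apply, ContinuousLinearMap.comp_apply, map_smul, ContinuousLinearMap.id_apply,
      smul_eq_mul]
    field_simp
  have hDφ : ∀ x, |s ^ 2 * φ (s⁻¹ • (x - c))| < d₀ := by
    intro x
    have h1 := hB₁ (s⁻¹ • (x - c))
    rw [Real.norm_eq_abs] at h1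
    rw [abs_mul, abs_of_pos (by positivity : 0 < s ^ 2)]
    calc s ^ 2 * |φ (s⁻¹ • (x - c))| ≤ s ^ 2 * B₁ := by gcongr
      _ = s * (s * B₁) := by ring
      _ ≤ 1 * (s * B₁) := by gcongr
      _ < d₀ := by rwa [one_mul]
  refine ⟨D, ?_, fun x => ?_, fun x => ?_, fun x => ?_, ?_, fun x hx => ?_, ?_⟩
  · have h1 : ContDiff ℝ 2 fun x : E => s⁻¹ • (x - c) :=
      (contDiff_id.sub contDiff_const).const_smul s⁻¹
    exact contDiff_const.add (contDiff_const.mul (hφC.comp h1))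
  · rw [(hDd x).fderiv, norm_smul, Real.norm_of_nonneg hs.le]
    exact (mul_le_mul_of_nonneg_left (hB₂ _) hs.le).trans hsε
  · have := (abs_lt.1 (hDφ x)).1
    simp only [hD]; linarith
  · have := (abs_lt.1 (hDφ x)).2
    simp only [hD]; linarith
  · simp [hD, hφ0]
  · rw [(hDd x).fderiv, hφd0, smul_zero]
    rw [norm_smul, norm_inv, Real.norm_of_nonneg hs.le, lt_inv_mul_iff₀ hs]
    linarith
  · have h1 : Metric.ball c s ∈ 𝓝 c := Metric.ball_mem_nhds c hs
    filter_upwards [h1] with x hx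
    have h2 : D =ᶠ[𝓝 x] fun y => d₀ + 1 / 2 * ⟪G (y - c), y - c⟫ := by
      filter_upwards [Metric.isOpen_ball.mem_nhds hx] with y hy
      have h3 : χ (s⁻¹ • (y - c)) = 1 := by
        apply χ.one_of_mem_closedBall
        rw [mem_closedBall_zero_iff, norm_smul, norm_inv, Real.norm_of_nonneg hs.le,
          inv_mul_le_iff₀ hs]
        rw [Metric.mem_ball, dist_eq_norm] at hy
        change _ ≤ s * 1
        linarith
      simp only [hD, hφ, h3, map_smul, inner_smul_left, inner_smul_right, conj_trivial]
      field_simp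
    have h4 : HasFDerivAt (fun y : E => y - c) (ContinuousLinearMap.id ℝ E) x :=
      (hasFDerivAt_id x).sub_const c
    have h5 := (G.hasFDerivAt.comp x h4).inner ℝ h4
    refine HasFDerivAt.congr_of_eventuallyEq ?_ h2
    refine ((h5.const_mul (1 / 2)).const_add d₀).congr_fderiv ?_
    ext1 v
    simp only [smul_apply, ContinuousLinearMap.comp_apply, fderivInnerCLM_apply,
      ContinuousLinearMap.prod_apply, ContinuousLinearMap.id_apply, innerSL_apply_apply,
      Function.comp_apply, smul_eq_mul]
    rw [hG v, real_inner_comm (G (x - c)) v]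
    ring

theorem norm_tangentProj_le (v : E) : ‖tangentProj C c v‖ ≤ ‖v‖ := by
  have h1 := (tangentProj C c).le_opNorm v
  have h2 : ‖tangentProj C c‖ ≤ 1 := Submodule.starProjection_norm_le _
  nlinarith [norm_nonneg v]

theorem norm_surfaceGrad_le {ν : E} (h : IsOutwardUnitNormal C c ν) {D : E → ℝ}
    (hD : DifferentiableAt ℝ D c) : ‖surfaceGrad C D c‖ ≤ ‖fderiv ℝ D c‖ := by
  rw [surfaceGrad_eq_of_hasFDerivWithinAt h hD.hasFDerivAt.hasFDerivWithinAt]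
  refine (norm_tangentProj_le _).trans ?_
  rw [LinearIsometryEquiv.norm_map]

theorem IsConvexCore.continuousWithinAt_tangentProj (hC : IsConvexCore C) (hc : c ∈ frontier C) :
    ContinuousWithinAt (tangentProj C) (frontier C) c := by
  have h1 : ∀ z ∈ frontier C, tangentProj C z =
      ContinuousLinearMap.id ℝ E - (innerSL ℝ (outwardNormal C z)).smulRight (outwardNormal C z) :=
    fun z hz => tangentProj_eq (hC.isOutwardUnitNormal hz)
  have h2 : Continuous fun ν : E => (innerSL ℝ ν).smulRight ν := by
    have h4 : Continuous fun p : (E →L[ℝ] ℝ) × E => p.1.smulRight p.2 := by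
      fun_prop
    exact h4.comp ((innerSL ℝ).continuous.prodMk continuous_id)
  exact (continuousWithinAt_const.sub (h2.continuousAt.comp_continuousWithinAt
    (hC.continuousWithinAt_outwardNormal hc))).congr h1 (h1 c hc)

/-- Half-lines from the boundary of a nearly constant tube hit the core. -/
theorem IsConvexCore.exists_hit (hC : IsConvexCore C) (hc : c ∈ frontier C) {d₀ : ℝ}
    (hd₀ : 0 < d₀) : ∃ ε > 0, ∃ r > 0, ∀ z ∈ frontier C, ‖z - c‖ < r → ∀ (m : E) (d : ℝ),
      ‖m‖ ≤ ε → 0 ≤ d → d < 2 * d₀ → ∃ t : ℝ, 0 ≤ t ∧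
        z + d • outwardNormal C z - t • (outwardNormal C z - m) ∈ C := by
  have hn := hC.isOutwardUnitNormal hc
  have hneg : ⟪-outwardNormal C c, outwardNormal C c⟫ < 0 := by
    rw [inner_neg_left, real_inner_self_eq_norm_sq, hn.1]; norm_num
  obtain ⟨τ, hτ, hτ0⟩ := ((hn.interior.eventually_mem hneg).and self_mem_nhdsWithin).exists
  have hτ0' : 0 < τ := hτ0
  obtain ⟨δ, hδ, hball⟩ := Metric.mem_nhds_iff.1 (mem_interior_iff_mem_nhds.1 hτ)
  have h1 : Tendsto (fun z => z + τ • -outwardNormal C z) (𝓝[frontier C] c)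
      (𝓝 (c + τ • -outwardNormal C c)) :=
    (tendsto_id.mono_left nhdsWithin_le_nhds).add
      ((hC.continuousWithinAt_outwardNormal hc).tendsto.neg.const_smul τ)
  have h2 := Metric.tendsto_nhds.1 h1 (δ / 2) (by positivity)
  rw [eventually_nhdsWithin_iff] at h2
  obtain ⟨r, hr, hr'⟩ := Metric.eventually_nhds_iff.1 h2
  -- At time `d + τ` the half-line is at `z - τ ν(z) + (d + τ) m`. Its first part is within `δ/2` of
  -- an interior point of `C`, and `ε` keeps the second part below `δ/2`.
  refine ⟨δ / 2 / (2 * d₀ + τ), by positivity, r, hr, fun z hz hzr m d hm hd hd2 =>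
    ⟨d + τ, by positivity, hball ?_⟩⟩
  have h3 := hr' (by rwa [dist_eq_norm]) hz
  have h4 : z + d • outwardNormal C z - (d + τ) • (outwardNormal C z - m) =
      z + τ • -outwardNormal C z + (d + τ) • m := by module
  have h5 : ‖(d + τ) • m‖ ≤ δ / 2 := by
    rw [norm_smul, Real.norm_of_nonneg (by positivity)]
    rw [le_div_iff₀ (by positivity)] at hm
    nlinarith [norm_nonneg m]
  rw [h4, Metric.mem_ball, dist_eq_norm]
  rw [dist_eq_norm] at h3
  have h6 : ‖z + τ • -outwardNormal C z + (d + τ) • m - (c + τ • -outwardNormal C c)‖ ≤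
      ‖z + τ • -outwardNormal C z - (c + τ • -outwardNormal C c)‖ + ‖(d + τ) • m‖ := by
    refine le_trans (le_of_eq ?_) (norm_add_le _ _)
    congr 1; abel
  linarith

/-- Every convex core has domains with prescribed thickness and prescribed nondegenerate Hessian
at a prescribed point. -/
theorem IsConvexCore.exists_configuration (hC : IsConvexCore C) (hc : c ∈ frontier C) {d₀ : ℝ}
    (hd₀ : 0 < d₀) (G : E →L[ℝ] E) (hG : ∀ v w, ⟪G v, w⟫ = ⟪v, G w⟫)
    (hGν : G (outwardNormal C c) = 0)
    (hinj : ∀ v, ⟪outwardNormal C c, v⟫ = 0 → G v = 0 → v = 0) :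
    ∃ Ω, IsCriticalConfiguration C Ω c ∧ thickness C Ω c = d₀ ∧ thicknessHess C Ω c = G := by
  have hn := hC.isOutwardUnitNormal hc
  obtain ⟨ε, hε, r, hr, hhit⟩ := hC.exists_hit hc hd₀
  obtain ⟨D, hDC, hDε, hDpos, hD2, hDc, hDr, hDG⟩ :=
    exists_bump c G hG hd₀ (lt_min hε (by norm_num : (0 : ℝ) < 1 / 2)) hr
  have hDdiff : Differentiable ℝ D := hDC.differentiable (by norm_num)
  have hthick : ∀ z ∈ frontier C, thickness C (tube C D) z = D z :=
    fun z hz => hC.thickness_tube hz hDpos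
  have hlip : LipschitzWith (1 / 2) D := by
    refine lipschitzWith_of_nnnorm_fderiv_le hDdiff fun x => ?_
    rw [← NNReal.coe_le_coe, coe_nnnorm]
    refine ((hDε x).trans (min_le_right _ _)).trans ?_
    simp
  have hadm : IsAdmissible C (tube C D) := by
    refine hC.isAdmissible_tube hlip hDdiff hDpos fun z hz => ?_
    have hnz := hC.isOutwardUnitNormal hz
    -- Near `c` the small gradient ensures a hit; away from `c` the thickness has zero gradient and
    -- the normal line returns to its foot point.
    rcases lt_or_ge ‖z - c‖ r with h | h
    · refine hhit z hz h _ _ ?_ (hDpos z).le (hD2 z)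
      refine (hC.norm_parallelInverse_le hz (hDpos z).le _).trans ?_
      exact (norm_surfaceGrad_le hnz (hDdiff z)).trans ((hDε z).trans (min_le_left _ _))
    · have h0 : surfaceGrad C D z = 0 := by
        have := norm_surfaceGrad_le hnz (hDdiff z)
        rw [hDr z h, norm_zero] at this
        exact norm_le_zero_iff.1 this
      refine ⟨D z, (hDpos z).le, ?_⟩
      rw [radialCovector, h0, map_zero, sub_zero, add_sub_cancel_right]
      exact hC.mem_of_frontier hz
  have hgrad : ∀ᶠ z in 𝓝[frontier C] c,
      surfaceGrad C (thickness C (tube C D)) z = tangentProj C z (G (z - c)) := by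
    filter_upwards [nhdsWithin_le_nhds hDG, self_mem_nhdsWithin] with z hz hzC
    rw [surfaceGrad_eq_of_hasFDerivWithinAt (hC.isOutwardUnitNormal hzC)
      (hz.hasFDerivWithinAt.congr hthick (hthick z hzC))]
    congr 1
    refine ext_inner_right ℝ fun v => ?_
    rw [InnerProductSpace.toDual_symm_apply, innerSL_apply_apply]
  have hgc := hgrad.self_of_nhdsWithin hc
  rw [sub_self, map_zero, map_zero] at hgc
  have hGT : ∀ v, tangentProj C c (G v) = G v := fun v => by
    apply tangentProj_of_inner_eq_zero hn
    rw [← hG, hGν, inner_zero_left]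
  have hGpr : ∀ v, G (tangentProj C c v) = G v := fun v => by
    rw [tangentProj_apply hn, map_sub, map_smul, hGν, smul_zero, sub_zero]
  have hHess : surfaceHess C (thickness C (tube C D)) c = G := by
    have h1 : HasFDerivWithinAt (fun z => G (z - c)) G (frontier C) c :=
      (G.hasFDerivAt.comp c ((hasFDerivAt_id (𝕜 := ℝ) c).sub_const c)).hasFDerivWithinAt
    -- `G (z - c)` vanishes at `c`, so the turning of the tangent space does not contribute to the
    -- Hessian.
    have h2 := hasFDerivWithinAt_clm_apply_of_eq_zero (hC.continuousWithinAt_tangentProj hc) h1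
      (by rw [sub_self, map_zero])
    have h3 := h2.congr_of_eventuallyEq hgrad (hgrad.self_of_nhdsWithin hc)
    rw [surfaceHess, surfaceDeriv_eq_of_hasFDerivWithinAt hn h3]
    ext1 v
    simp only [ContinuousLinearMap.comp_apply, hGT, hGpr]
  refine ⟨tube C D, ⟨hC, hadm, hDC.contDiffOn.congr hthick, hc, hgc, fun v hv hv0 => ?_⟩,
    by rw [hthick c hc, hDc], hHess⟩
  rw [hHess] at hv0
  exact hinj v ((mem_tangentSpace_iff hn v).1 hv) hv0

/-! ### Ellipsoids -/

/-- The quadratic function `⟪Q (y - c), y - c⟫ / 2 + ⟪ν, y - c⟫`. -/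
noncomputable def quadric (c ν : E) (Q : E →L[ℝ] E) (y : E) : ℝ :=
  1 / 2 * ⟪Q (y - c), y - c⟫ + ⟪ν, y - c⟫

/-- The solid ellipsoid through `c` with outward normal `ν` and second fundamental form `Q`. -/
def ellipsoid (c ν : E) (Q : E →L[ℝ] E) : Set E := {y | quadric c ν Q y ≤ 0}

section Ellipsoid

variable {ν : EuclideanSpace ℝ (Fin N)}
  {Q : EuclideanSpace ℝ (Fin N) →L[ℝ] EuclideanSpace ℝ (Fin N)}

theorem contDiff_quadric (c ν : E) (Q : E →L[ℝ] E) : ContDiff ℝ 2 (quadric c ν Q) := by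
  have h1 : ContDiff ℝ 2 fun y : E => y - c := contDiff_id.sub contDiff_const
  exact (contDiff_const.mul ((Q.contDiff.comp h1).inner ℝ h1)).add (contDiff_const.inner ℝ h1)

theorem hasFDerivAt_quadric (hQ : ∀ v w, ⟪Q v, w⟫ = ⟪v, Q w⟫) (y : E) :
    HasFDerivAt (quadric c ν Q) (innerSL ℝ (ν + Q (y - c))) y := by
  have h4 : HasFDerivAt (fun y : E => y - c) (ContinuousLinearMap.id ℝ E) y :=
    (hasFDerivAt_id y).sub_const c
  have h5 := (Q.hasFDerivAt.comp y h4).inner ℝ h4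
  have h6 := (innerSL ℝ ν).hasFDerivAt.comp y h4
  refine ((h5.const_mul (1 / 2)).add h6).congr_fderiv ?_
  ext1 v
  simp only [add_apply, smul_apply, ContinuousLinearMap.comp_apply, fderivInnerCLM_apply,
    ContinuousLinearMap.prod_apply, ContinuousLinearMap.id_apply, innerSL_apply_apply,
    Function.comp_apply, smul_eq_mul, inner_add_left]
  rw [hQ v, real_inner_comm (Q (y - c)) v]
  ring

theorem quadric_convex_comb (hQ : ∀ v w, ⟪Q v, w⟫ = ⟪v, Q w⟫) (x y : E) {a b : ℝ}
    (hab : a + b = 1) : quadric c ν Q (a • x + b • y) =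
      a * quadric c ν Q x + b * quadric c ν Q y - 1 / 2 * (a * b * ⟪Q (x - y), x - y⟫) := by
  have h1 : a • x + b • y - c = a • (x - c) + b • (y - c) := by
    obtain rfl : b = 1 - a := by linarith
    module
  have h2 : x - y = (x - c) - (y - c) := by abel
  rw [quadric, quadric, quadric, h1, h2]
  generalize x - c = u
  generalize y - c = v
  obtain rfl : b = 1 - a := by linarith
  simp only [map_add, map_sub, map_smul, inner_add_left, inner_add_right, inner_sub_left,
    inner_sub_right, inner_smul_left, inner_smul_right, conj_trivial]
  rw [hQ v u, real_inner_comm (Q u) v]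
  ring

/-- Coercivity of `Q` makes the quadric strongly convex, giving boundedness and convexity; its slope
`ν` at `c` supplies interior points. -/
theorem isConvexCore_ellipsoid (hν : ‖ν‖ = 1) (hQ : ∀ v w, ⟪Q v, w⟫ = ⟪v, Q w⟫) {κ : ℝ}
    (hκ : 0 < κ) (hQκ : ∀ v, κ * ‖v‖ ^ 2 ≤ ⟪Q v, v⟫) : IsConvexCore (ellipsoid c ν Q) := by
  have hcont : Continuous (quadric c ν Q) := (contDiff_quadric c ν Q).continuous
  have hcl : IsClosed (ellipsoid c ν Q) := isClosed_le hcont continuous_const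
  refine ⟨?_, ?_, ?_, fun y hy => ?_⟩
  · refine Metric.isCompact_of_isClosed_isBounded hcl ?_
    refine (Metric.isBounded_closedBall (x := c) (r := 2 / κ)).subset fun y hy => ?_
    rw [Metric.mem_closedBall, dist_eq_norm]
    have h1 : 1 / 2 * ⟪Q (y - c), y - c⟫ + ⟪ν, y - c⟫ ≤ 0 := hy
    have h2 := (abs_le.1 (abs_real_inner_le_norm ν (y - c))).1
    rw [hν, one_mul] at h2
    have h3 := hQκ (y - c)
    rw [le_div_iff₀ hκ]
    by_contra! hlt
    nlinarith [norm_nonneg (y - c)]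
  · intro x hx y hy a b ha hb hab
    change quadric c ν Q _ ≤ 0
    rw [quadric_convex_comb hQ x y hab]
    have h1 : 0 ≤ ⟪Q (x - y), x - y⟫ := le_trans (by positivity) (hQκ (x - y))
    have h2 := mul_nonpos_of_nonneg_of_nonpos ha (show quadric c ν Q x ≤ 0 from hx)
    have h3 := mul_nonpos_of_nonneg_of_nonpos hb (show quadric c ν Q y ≤ 0 from hy)
    have h4 : 0 ≤ a * b * ⟪Q (x - y), x - y⟫ := by positivity
    linarith
  · have h1 : ∃ y, quadric c ν Q y < 0 := by
      have h2 := isOutwardUnitNormal_of_hasFDerivAt (S := {y | quadric c ν Q y < 0})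
        (h := quadric c ν Q) (w := ν) (x := c) (by
          have h3 := hasFDerivAt_quadric (c := c) (ν := ν) hQ c
          rwa [sub_self, map_zero, add_zero] at h3)
        (by simp [quadric]) (norm_ne_zero_iff.1 (by rw [hν]; norm_num))
        (Eventually.of_forall fun y => ⟨id, fun h h' => lt_asymm h h'⟩)
      rw [hν, inv_one, one_smul] at h2
      obtain ⟨t, ht⟩ := (h2.eventually_mem (u := -ν) (by
        rw [inner_neg_left, real_inner_self_eq_norm_sq, hν]; norm_num)).exists
      exact ⟨_, ht⟩
    obtain ⟨y, hy⟩ := h1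
    refine ⟨y, mem_interior.2 ⟨{y | quadric c ν Q y < 0}, fun z hz => ?_,
      isOpen_lt hcont continuous_const, hy⟩⟩
    exact le_of_lt (show quadric c ν Q z < 0 from hz)
  · have h0 : quadric c ν Q y = 0 :=
      frontier_le_subset_eq hcont continuous_const hy
    refine ⟨quadric c ν Q, (contDiff_quadric c ν Q).contDiffAt, fun hd => ?_,
      Eventually.of_forall fun z => Iff.rfl⟩
    rw [(hasFDerivAt_quadric hQ y).fderiv] at hd
    -- Subtracting the equation of the quadric leaves `½⟪Q(y - c), y - c⟫ = 0`, so `y = c`, where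
    -- the gradient is `ν ≠ 0`.
    have h1 : ⟪ν + Q (y - c), y - c⟫ = 0 := by
      have := congrArg (fun L : E →L[ℝ] ℝ => L (y - c)) hd
      exact this
    rw [quadric] at h0
    rw [inner_add_left] at h1
    have h2 := hQκ (y - c)
    have h3 : κ * ‖y - c‖ ^ 2 ≤ 0 := by linarith
    have h4 : y - c = 0 := by
      by_contra hne
      have := norm_pos_iff.2 hne
      have : 0 < κ * ‖y - c‖ ^ 2 := by positivity
      linarith
    rw [h4, map_zero, add_zero] at hd
    have h5 := congrArg (fun L : E →L[ℝ] ℝ => L ν) hd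
    simp only [innerSL_apply_apply, real_inner_self_eq_norm_sq, hν, zero_apply] at h5
    norm_num at h5

theorem isOutwardUnitNormal_ellipsoid (hQ : ∀ v w, ⟪Q v, w⟫ = ⟪v, Q w⟫) {y : E}
    (hy : quadric c ν Q y = 0) (hw : ν + Q (y - c) ≠ 0) :
    IsOutwardUnitNormal (ellipsoid c ν Q) y (‖ν + Q (y - c)‖⁻¹ • (ν + Q (y - c))) :=
  isOutwardUnitNormal_of_hasFDerivAt (hasFDerivAt_quadric hQ y) hy hw
    (Eventually.of_forall fun _ => ⟨fun h => h.le, fun h h' => absurd h (not_lt.2 h')⟩)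

theorem isOutwardUnitNormal_ellipsoid_self (hν : ‖ν‖ = 1) (hQ : ∀ v w, ⟪Q v, w⟫ = ⟪v, Q w⟫) :
    IsOutwardUnitNormal (ellipsoid c ν Q) c ν := by
  have h := isOutwardUnitNormal_ellipsoid (c := c) (ν := ν) (y := c) hQ (by simp [quadric])
    (by rw [sub_self, map_zero, add_zero]; exact norm_ne_zero_iff.1 (by rw [hν]; norm_num))
  simpa [hν] using h

theorem mem_frontier_ellipsoid (hν : ‖ν‖ = 1) (hQ : ∀ v w, ⟪Q v, w⟫ = ⟪v, Q w⟫) :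
    c ∈ frontier (ellipsoid c ν Q) := by
  refine ⟨subset_closure ?_, fun hint => ?_⟩
  · change quadric c ν Q c ≤ 0
    simp [quadric]
  · have h1 := (isOutwardUnitNormal_ellipsoid_self (c := c) hν hQ).eventually_notMem (u := ν)
      (by rw [real_inner_self_eq_norm_sq, hν]; norm_num)
    obtain ⟨t, ht, ht'⟩ :=
      (h1.and (eventually_ray (u := ν) (mem_interior_iff_mem_nhds.1 hint))).exists
    exact ht ht'

/-- The normal is `w / ‖w‖` with `w = ν + Q(y - c)`. At `c` the derivative of the normalizing factor
contributes only along `ν`, so the tangential part is that of `Q`. -/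
theorem shapeOperator_ellipsoid (hν : ‖ν‖ = 1) (hQ : ∀ v w, ⟪Q v, w⟫ = ⟪v, Q w⟫) {κ : ℝ}
    (hκ : 0 < κ) (hQκ : ∀ v, κ * ‖v‖ ^ 2 ≤ ⟪Q v, v⟫) (v : E) :
    shapeOperator (ellipsoid c ν Q) c v = -tangentProj (ellipsoid c ν Q) c
      (Q (tangentProj (ellipsoid c ν Q) c v)) := by
  set S := ellipsoid c ν Q with hS
  have hC : IsConvexCore S := isConvexCore_ellipsoid hν hQ hκ hQκ
  have hc : c ∈ frontier S := mem_frontier_ellipsoid hν hQ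
  have hn : IsOutwardUnitNormal S c ν := isOutwardUnitNormal_ellipsoid_self hν hQ
  have hν0 : ν ≠ 0 := norm_ne_zero_iff.1 (by rw [hν]; norm_num)
  set w : E → E := fun y => ν + Q (y - c) with hwdef
  have hwc : w c = ν := by simp [hwdef]
  have hwC : ContDiff ℝ 1 w :=
    contDiff_const.add (Q.contDiff.comp (contDiff_id.sub contDiff_const))
  have hwd : HasFDerivAt w Q c :=
    ((Q.hasFDerivAt.comp c ((hasFDerivAt_id (𝕜 := ℝ) c).sub_const c)).const_add ν).congr_fderiv
      (by ext1 v; rfl)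
  have hinv : ContDiffAt ℝ 1 (fun y => ‖w y‖⁻¹) c :=
    (hwC.contDiffAt.norm ℝ (by rwa [hwc])).inv (norm_ne_zero_iff.2 (by rwa [hwc]))
  have hcont : Continuous (quadric c ν Q) := (contDiff_quadric c ν Q).continuous
  have hnorm : ∀ᶠ z in 𝓝[frontier S] c, IsOutwardUnitNormal S z (‖w z‖⁻¹ • w z) := by
    have h1 : ∀ᶠ z in 𝓝 c, w z ≠ 0 := hwC.continuous.continuousAt.eventually_ne (by rwa [hwc])
    filter_upwards [nhdsWithin_le_nhds h1, self_mem_nhdsWithin] with z hz hzS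
    exact isOutwardUnitNormal_ellipsoid hQ
      (frontier_le_subset_eq hcont continuous_const hzS) hz
  rw [shapeOperator_eq hc (hinv.smul hwC.contDiffAt) hnorm]
  have hd := ((hinv.differentiableAt (by norm_num)).hasFDerivAt.smul hwd).fderiv
  have h2 := hC.inner_outwardNormal_shapeOperator hc v
  rw [hn.outwardNormal_eq, shapeOperator_eq hc (hinv.smul hwC.contDiffAt) hnorm, neg_apply,
    inner_neg_right, neg_eq_zero] at h2
  rw [neg_apply, neg_inj, ← tangentProj_of_inner_eq_zero hn h2, ContinuousLinearMap.comp_apply, hd]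
  simp only [add_apply, smul_apply, ContinuousLinearMap.smulRight_apply, map_add, map_smul, hwc,
    tangentProj_normal hn, hν]
  simp

end Ellipsoid

/-! ### Changing the factors of the linearization -/

theorem geometricOperator_apply (C Ω : Set E) (c v : E) : geometricOperator C Ω c v =
    (2 * thickness C Ω c) • parallelInverse C c (thickness C Ω c) (tangentProj C c v) := rfl

/-- This is where `N ≥ 2` enters: a nonzero tangent vector is needed to tell the operators apart. -/
theorem exists_tangent_ne_zero (hN : 2 ≤ N) (ν : E) : ∃ v : E, ⟪ν, v⟫ = 0 ∧ v ≠ 0 := by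
  by_contra! hcon
  have h1 : (ℝ ∙ ν)ᗮ = ⊥ := by
    rw [Submodule.eq_bot_iff]
    intro v hv
    exact hcon v (Submodule.mem_orthogonal_singleton_iff_inner_right.1 hv)
  have h2 := Submodule.finrank_add_finrank_orthogonal (ℝ ∙ ν)
  rw [h1, finrank_bot, finrank_euclideanSpace_fin] at h2
  have h3 := finrank_span_le_card (R := ℝ) ({ν} : Set E)
  rw [toFinset_singleton, Finset.card_singleton] at h3
  omega

theorem tangentProj_tangentProj {ν : E} (h : IsOutwardUnitNormal C c ν) (v : E) :
    tangentProj C c (tangentProj C c v) = tangentProj C c v :=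
  tangentProj_of_inner_eq_zero h (inner_tangentProj h v)

theorem inner_tangentProj_comm {ν : E} (h : IsOutwardUnitNormal C c ν) (v w : E) :
    ⟪tangentProj C c v, w⟫ = ⟪v, tangentProj C c w⟫ := by
  rw [tangentProj_apply h, tangentProj_apply h, inner_sub_left, inner_sub_right, inner_smul_left,
    inner_smul_right, real_inner_comm v ν, conj_trivial]
  ring

/-- Any configuration can be modified, with a new core, so that the linearization is kept but
both factors change. -/
theorem IsCriticalConfiguration.exists_ne (hN : 2 ≤ N) (h : IsCriticalConfiguration C Ω c) :
    ∃ C' Ω' : Set E, IsCriticalConfiguration C' Ω' c ∧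
      outwardNormal C' c = outwardNormal C c ∧ linearization C' Ω' c = linearization C Ω c ∧
      geometricOperator C' Ω' c ≠ geometricOperator C Ω c ∧
      thicknessHess C' Ω' c ≠ thicknessHess C Ω c := by
  have hC := h.core
  have hc := h.critical.1
  have hn := hC.isOutwardUnitNormal hc
  have hd := h.admissible.thickness_pos hC hc
  set d := thickness C Ω c with hddef
  set ν := outwardNormal C c with hν
  set H := thicknessHess C Ω c with hH
  have hHess : H = surfaceDeriv C (surfaceGrad C (thickness C Ω)) c := h.thicknessHess_eq
  have hHν : H ν = 0 := by
    rw [hHess]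
    exact (hasSurfaceDerivAt_surfaceDeriv hn
      (hC.differentiableWithinAt_surfaceGrad hc (h.thickness_C2 c hc))).2
  have hHsymm : ∀ v w, ⟪H v, w⟫ = ⟪v, H w⟫ :=
    hC.inner_surfaceHess hc h.thickness_C2 h.critical.2.1
  have hHinj : ∀ v, ⟪ν, v⟫ = 0 → H v = 0 → v = 0 := fun v hv =>
    h.critical.2.2 v ((mem_tangentSpace_iff hn v).2 hv)
  -- Chosen so that the new shape operator is `2S - I/d` on the tangent space; `S ≤ 0` makes `Q ≥
  -- I/d`, as an ellipsoid requires.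
  set Q : E →L[ℝ] E := d⁻¹ • ContinuousLinearMap.id ℝ E - (2 : ℝ) • shapeOperator C c with hQdef
  have hQapply : ∀ v, Q v = d⁻¹ • v - (2 : ℝ) • shapeOperator C c v := fun v => rfl
  have hQ : ∀ v w, ⟪Q v, w⟫ = ⟪v, Q w⟫ := fun v w => by
    rw [hQapply, hQapply, inner_sub_left, inner_sub_right, inner_smul_left, inner_smul_left,
      inner_smul_right, inner_smul_right, hC.inner_shapeOperator hc]
    simp
  have hQκ : ∀ v, d⁻¹ * ‖v‖ ^ 2 ≤ ⟪Q v, v⟫ := fun v => by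
    rw [hQapply, inner_sub_left, inner_smul_left, inner_smul_left, real_inner_self_eq_norm_sq]
    have := hC.inner_shapeOperator_self_nonpos hc v
    simp only [conj_trivial]
    linarith
  set C' := ellipsoid c ν Q with hC'def
  have hC' : IsConvexCore C' := isConvexCore_ellipsoid hn.1 hQ (inv_pos.2 hd) hQκ
  have hc' : c ∈ frontier C' := mem_frontier_ellipsoid hn.1 hQ
  have hn' : IsOutwardUnitNormal C' c ν := isOutwardUnitNormal_ellipsoid_self hn.1 hQ
  have hνeq : outwardNormal C' c = ν := hn'.outwardNormal_eq
  have hpr : tangentProj C' c = tangentProj C c := tangentProj_congr hνeq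
  have hS' : ∀ v, shapeOperator C' c v =
      (2 : ℝ) • shapeOperator C c v - d⁻¹ • tangentProj C c v := fun v => by
    rw [shapeOperator_ellipsoid hn.1 hQ (inv_pos.2 hd) hQκ, ← hC'def, hpr, hQapply, map_sub,
      map_smul, map_smul, tangentProj_tangentProj hn, hC.shapeOperator_tangentProj hc,
      tangentProj_of_inner_eq_zero hn (hC.inner_outwardNormal_shapeOperator hc v)]
    abel
  obtain ⟨Ω', hΩ', hd', hH'⟩ := hC'.exists_configuration hc' hd ((2 : ℝ) • H)
    (fun v w => by
      rw [smul_apply, smul_apply, inner_smul_left, inner_smul_right, hHsymm, conj_trivial])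
    (by rw [hνeq, smul_apply, hHν, smul_zero])
    (fun v hv hv0 => hHinj v (by rwa [hνeq] at hv)
      ((smul_eq_zero_iff_right (two_ne_zero (α := ℝ))).1 hv0))
  -- On tangent vectors `I - dS' = 2(I - dS)`.
  have hM : ∀ v, parallelInverse C' c d (tangentProj C c v) =
      (1 / 2 : ℝ) • parallelInverse C c d (tangentProj C c v) := fun v => by
    set m := parallelInverse C c d (tangentProj C c v) with hm
    have h1 : tangentProj C c m = m := by
      apply tangentProj_of_inner_eq_zero hn
      rw [hm, hC.inner_outwardNormal_parallelInverse hc hd.le, inner_tangentProj hn]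
    have h2 : m - d • shapeOperator C c m = tangentProj C c v := hC.parallelInverse_sub hc hd.le _
    have h3 := hC'.parallelInverse_apply_sub hc' hd.le ((1 / 2 : ℝ) • m)
    rw [← h3, hS', map_smul, map_smul, h1, ← h2]
    congr 1
    rw [smul_sub, smul_smul d d⁻¹, mul_inv_cancel₀ hd.ne']
    module
  have hA : ∀ v, geometricOperator C' Ω' c v = (1 / 2 : ℝ) • geometricOperator C Ω c v := fun v => by
    rw [geometricOperator_apply, geometricOperator_apply, hd', ← hddef, hpr, hM, smul_comm]
  obtain ⟨v, hv, hv0⟩ := exists_tangent_ne_zero hN ν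
  refine ⟨C', Ω', hΩ', hνeq, (hΩ'.linearization_eq_iff h hνeq).2 ?_, fun heq => ?_, fun heq => ?_⟩
  · ext1 u
    rw [ContinuousLinearMap.comp_apply, ContinuousLinearMap.comp_apply, hA, hH', smul_apply,
      map_smul, smul_smul]
    norm_num
    rfl
  · have h1 := hA v
    rw [heq] at h1
    have h2 : geometricOperator C Ω c v = 0 := by
      have h3 : (1 / 2 : ℝ) • geometricOperator C Ω c v = 0 := by
        have h4 : (1 / 2 : ℝ) • geometricOperator C Ω c v =
          geometricOperator C Ω c v - (1 / 2 : ℝ) • geometricOperator C Ω c v := by module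
        rw [h4, ← h1, sub_self]
      exact (smul_eq_zero_iff_right (by norm_num)).1 h3
    rw [geometricOperator_apply, tangentProj_of_inner_eq_zero hn hv,
      smul_eq_zero_iff_right (by positivity)] at h2
    have h5 := hC.parallelInverse_sub hc hd.le v
    rw [h2, map_zero, smul_zero, sub_zero] at h5
    exact hv0 h5.symm
  · rw [hH'] at heq
    have h1 : (2 : ℝ) • H v = H v := congrArg (fun L : E →L[ℝ] E => L v) heq
    rw [two_smul, add_eq_left] at h1
    exact hv0 (hHinj v hv h1)

/-- The Hessian `(I / d - S)` on the tangent space, for which the composite operator is twice the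
identity. -/
noncomputable def balancedHess (C : Set E) (c : E) (d : ℝ) : E →L[ℝ] E :=
  d⁻¹ • tangentProj C c - shapeOperator C c

/-- With `I/d - S = (I - dS)/d`, the composite is `2d (I - dS)⁻¹ (I - dS)/d = 2I` on the tangent
space, whatever `d` is. Since `S ≤ 0`, this Hessian is positive definite there, hence admissible as
a nondegenerate one. -/
theorem IsConvexCore.exists_balanced_configuration (hC : IsConvexCore C) (hc : c ∈ frontier C)
    {d : ℝ} (hd : 0 < d) : ∃ Ω, IsCriticalConfiguration C Ω c ∧ thickness C Ω c = d ∧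
      thicknessHess C Ω c = balancedHess C c d ∧
      geometricOperator C Ω c ∘L thicknessHess C Ω c = (2 : ℝ) • tangentProj C c := by
  have hn := hC.isOutwardUnitNormal hc
  have happly : ∀ v, balancedHess C c d v = d⁻¹ • tangentProj C c v - shapeOperator C c v :=
    fun v => rfl
  have hsymm : ∀ v w, ⟪balancedHess C c d v, w⟫ = ⟪v, balancedHess C c d w⟫ := fun v w => by
    rw [happly, happly, inner_sub_left, inner_sub_right, inner_smul_left, inner_smul_right,
      hC.inner_shapeOperator hc, inner_tangentProj_comm hn, conj_trivial]
  have hν : balancedHess C c d (outwardNormal C c) = 0 := by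
    rw [happly, tangentProj_normal hn, hC.shapeOperator_outwardNormal hc, smul_zero, sub_zero]
  have hinj : ∀ v, ⟪outwardNormal C c, v⟫ = 0 → balancedHess C c d v = 0 → v = 0 := by
    intro v hv h0
    rw [happly, tangentProj_of_inner_eq_zero hn hv] at h0
    have h1 : ⟪d⁻¹ • v - shapeOperator C c v, v⟫ = 0 := by rw [h0, inner_zero_left]
    rw [inner_sub_left, inner_smul_left, real_inner_self_eq_norm_sq, conj_trivial] at h1
    have h2 := hC.inner_shapeOperator_self_nonpos hc v
    by_contra hne
    have h3 := norm_pos_iff.2 hne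
    have h4 : 0 < d⁻¹ * ‖v‖ ^ 2 := by positivity
    linarith
  obtain ⟨Ω, hΩ, hdΩ, hHΩ⟩ := hC.exists_configuration hc hd _ hsymm hν hinj
  refine ⟨Ω, hΩ, hdΩ, hHΩ, ?_⟩
  ext1 v
  have h1 : tangentProj C c (balancedHess C c d v) =
      d⁻¹ • (tangentProj C c v - d • shapeOperator C c (tangentProj C c v)) := by
    rw [happly, map_sub, map_smul, tangentProj_tangentProj hn,
      tangentProj_of_inner_eq_zero hn (hC.inner_outwardNormal_shapeOperator hc v),
      hC.shapeOperator_tangentProj hc, smul_sub, smul_smul, inv_mul_cancel₀ hd.ne', one_smul]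
  rw [ContinuousLinearMap.comp_apply, hHΩ, geometricOperator_apply, hdΩ, h1, map_smul,
    hC.parallelInverse_apply_sub hc hd.le, smul_smul, smul_apply]
  congr 1
  field_simp

/-- Around every core there are two domains with the same linearization at a prescribed point,
but different factors. -/
theorem IsConvexCore.exists_configurations_ne (hN : 2 ≤ N) (hC : IsConvexCore C)
    (hc : c ∈ frontier C) : ∃ Ω Ω' : Set E, IsCriticalConfiguration C Ω c ∧
      IsCriticalConfiguration C Ω' c ∧ linearization C Ω c = linearization C Ω' c ∧
      geometricOperator C Ω c ≠ geometricOperator C Ω' c ∧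
      thicknessHess C Ω c ≠ thicknessHess C Ω' c := by
  have hn := hC.isOutwardUnitNormal hc
  obtain ⟨v, hv, hv0⟩ := exists_tangent_ne_zero hN (outwardNormal C c)
  obtain ⟨Ω, h, hd, hH, hA⟩ := hC.exists_balanced_configuration hc one_pos
  obtain ⟨Ω', h', hd', hH', hA'⟩ := hC.exists_balanced_configuration hc two_pos
  have hne : thicknessHess C Ω c ≠ thicknessHess C Ω' c := by
    rw [hH, hH']
    intro heq
    have h1 : (1 : ℝ)⁻¹ • tangentProj C c v - shapeOperator C c v =
        (2 : ℝ)⁻¹ • tangentProj C c v - shapeOperator C c v :=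
      congrArg (fun L : E →L[ℝ] E => L v) heq
    rw [tangentProj_of_inner_eq_zero hn hv, sub_left_inj] at h1
    have h2 : (2 : ℝ)⁻¹ • v = 0 := by
      have h3 : (2 : ℝ)⁻¹ • v = (1 : ℝ)⁻¹ • v - (2 : ℝ)⁻¹ • v := by module
      rw [h3, h1, sub_self]
    exact hv0 ((smul_eq_zero_iff_right (by norm_num)).1 h2)
  refine ⟨Ω, Ω', h, h', (h.linearization_eq_iff h' rfl).2 (hA.trans hA'.symm), fun heq => ?_, hne⟩
  -- Test on `(I - S)v`: the operator for `d = 1` gives `2v`, so equality would force `(I - 2S)⁻¹(I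
  -- - S)v = v/2`. Applying `I - 2S` then gives `v - Sv = v/2 - Sv`, so `v = 0`.
  have h1 : geometricOperator C Ω c (v - (1 : ℝ) • shapeOperator C c v) =
      geometricOperator C Ω' c (v - (1 : ℝ) • shapeOperator C c v) := by rw [heq]
  have h2 : ⟪outwardNormal C c, v - (1 : ℝ) • shapeOperator C c v⟫ = 0 := by
    rw [inner_sub_right, inner_smul_right, hC.inner_outwardNormal_shapeOperator hc, hv]; simp
  rw [geometricOperator_apply, geometricOperator_apply, hd, hd', tangentProj_of_inner_eq_zero hn h2,
    hC.parallelInverse_apply_sub hc zero_le_one] at h1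
  have h3 := hC.parallelInverse_sub hc zero_le_two (v - (1 : ℝ) • shapeOperator C c v)
  have h4 : parallelInverse C c 2 (v - (1 : ℝ) • shapeOperator C c v) = (1 / 2 : ℝ) • v := by
    have h5 := congrArg (fun u : E => (1 / 4 : ℝ) • u) h1
    simp only [smul_smul] at h5
    norm_num at h5
    norm_num
    exact h5.symm
  rw [h4, map_smul] at h3
  have h6 : (1 / 2 : ℝ) • v = 0 := by
    have h7 : (1 / 2 : ℝ) • v = (v - (1 : ℝ) • shapeOperator C c v) -
      ((1 / 2 : ℝ) • v - (2 : ℝ) • (1 / 2 : ℝ) • shapeOperator C c v) := by module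
    rw [h7, h3, sub_self]
  exact hv0 ((smul_eq_zero_iff_right (by norm_num)).1 h6)

end RoundTrip

/-! ### The four statements together -/

theorem proposition6p3 (N : ℕ) (hN : 2 ≤ N) :
    -- the linearization of the return map at the fixed point `c` exists
    (∀ (C Ω : Set (EuclideanSpace ℝ (Fin N))) (c : EuclideanSpace ℝ (Fin N)),
      RoundTrip.IsCriticalConfiguration C Ω c →
        RoundTrip.returnMap C Ω c = c ∧
        ∃ L, RoundTrip.HasSurfaceDerivAt C (RoundTrip.returnMap C Ω) L c) ∧
    -- it determines the composite operator, and depends on nothing else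
    (∀ (C C' Ω Ω' : Set (EuclideanSpace ℝ (Fin N))) (c : EuclideanSpace ℝ (Fin N)),
      RoundTrip.IsCriticalConfiguration C Ω c → RoundTrip.IsCriticalConfiguration C' Ω' c →
      RoundTrip.outwardNormal C c = RoundTrip.outwardNormal C' c →
        (RoundTrip.linearization C Ω c = RoundTrip.linearization C' Ω' c ↔
          RoundTrip.geometricOperator C Ω c ∘L RoundTrip.thicknessHess C Ω c =
            RoundTrip.geometricOperator C' Ω' c ∘L RoundTrip.thicknessHess C' Ω' c)) ∧
    -- no configuration has factors that are determined by its linearization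
    (∀ (C Ω : Set (EuclideanSpace ℝ (Fin N))) (c : EuclideanSpace ℝ (Fin N)),
      RoundTrip.IsCriticalConfiguration C Ω c →
        ∃ C' Ω' : Set (EuclideanSpace ℝ (Fin N)),
          RoundTrip.IsCriticalConfiguration C' Ω' c ∧
          RoundTrip.outwardNormal C' c = RoundTrip.outwardNormal C c ∧
          RoundTrip.linearization C' Ω' c = RoundTrip.linearization C Ω c ∧
          RoundTrip.geometricOperator C' Ω' c ≠ RoundTrip.geometricOperator C Ω c ∧
          RoundTrip.thicknessHess C' Ω' c ≠ RoundTrip.thicknessHess C Ω c) ∧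
    -- even for a prescribed core and base point the linearization does not determine the factors
    (∀ (C : Set (EuclideanSpace ℝ (Fin N))) (c : EuclideanSpace ℝ (Fin N)),
      RoundTrip.IsConvexCore C → c ∈ frontier C →
        ∃ Ω Ω' : Set (EuclideanSpace ℝ (Fin N)),
          RoundTrip.IsCriticalConfiguration C Ω c ∧ RoundTrip.IsCriticalConfiguration C Ω' c ∧
          RoundTrip.linearization C Ω c = RoundTrip.linearization C Ω' c ∧
          RoundTrip.geometricOperator C Ω c ≠ RoundTrip.geometricOperator C Ω' c ∧
          RoundTrip.thicknessHess C Ω c ≠ RoundTrip.thicknessHess C Ω' c) := by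
  exact ⟨fun _ _ _ h => ⟨h.returnMap_spec.1, _, h.returnMap_spec.2⟩,
    fun _ _ _ _ _ h h' hν => h.linearization_eq_iff h' hν,
    fun _ _ _ h => h.exists_ne hN,
    fun _ _ hC hc => hC.exists_configurations_ne hN hc⟩
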